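/- Let $0<e<1$, $A>0$, $B>0$, $0\le p<\tfrac32$, and set $E=\dfrac{8}{1-e^2}$. Let $\mathcal P_2(\mathbb R^3)$ be the set of Borel probability measures on $\mathbb R^3$ with finite second moment; for $f\in\mathcal P_2(\mathbb R^3)$ let $\langle f\rangle=\int v\,df(v)$ be its mean velocity, $\theta(f)=\frac13\int|v-\langle f\rangle|^2\,df(v)$ its kinetic energy (temperature), and put $$\Theta^2(f)=\frac{EA}{B}\,\theta(f)^{p-1/2}.$$ Let $W_2(f,g)=\inf_\pi\big(\iint|v-w|^2\,d\pi(v,w)\big)^{1/2}$, where $\pi$ runs over the joint probability measures on $\mathbb R^3\times\mathbb R^3$ with marginals $f$ and $g$. The inelastic collision operator $Q$ is defined by $$(\varphi,Q(f,f))=\frac1{4\pi}\int_{\mathbb R^3}\int_{\mathbb R^3}\int_{S^2}\big[\varphi(v')-\varphi(v)\big]\,d\sigma\,df(v)\,df(w),\qquad v'=\frac{v+w}2+\frac{1-e}4(v-w)+\frac{1+e}4|v-w|\sigma .$$ A solution of $$\frac{\partial f}{\partial\tau}=E\,Q(f,f)+\Theta^2(f(\tau))\,\Delta_v f \qquad (*)$$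 with initial datum $f^0\in\mathcal P_2(\mathbb R^3)$ is a weakly continuous curve $f:[0,\infty)\to\mathcal P_2(\mathbb R^3)$ with $f(0)=f^0$ such that $\tau\mapsto\Theta^2(f(\tau))$ is defined for almost every $\tau$ (that is, $\theta(f(\tau))>0$ for a.e. $\tau$ if $p<\frac12$) and integrable on every $[0,T]$, and such that for all $\varphi\in C_c^\infty(\mathbb R^3)$ and $\tau\ge0$ $$\int\varphi\,df(\tau)=\int\varphi\,df^0+\int_0^\tau\Big(E\,(\varphi,Q(f(s),f(s)))+\Theta^2(f(s))\int\Delta\varphi\,df(s)\Big)ds .$$ **Theorem 3.4.** Let $f_1,f_2$ be two solutions of $(*)$ with respective initial data $f_1^0,f_2^0\in\mathcal P_2(\mathbb R^3)$ of the same kinetic energy, $\theta(f_1^0)=\theta(f_2^0)$; if $p>\frac12$, assume that this common value is positive. Then for all $\tau\ge0$ $$W_2^2(f_1(\tau),f_2(\tau))\le e^{-2\tau}\,W_2^2(f_1^0,f_2^0)+(1-e^{-2\tau})\,\big|\langle f_1^0\rangle-\langle f_2^0\rangle\big|^2 .$$ -/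

import Mathlib

open MeasureTheory Set
open scoped ENNReal ContDiff

namespace InelasticMaxwell

noncomputable section

/-- The velocity space `ℝ³` with its Euclidean norm. -/
abbrev Vel : Type := EuclideanSpace ℝ (Fin 3)

/-- Membership in `P₂(ℝ³)`: the Borel probability measure `f` has a finite second moment. -/
def InP2 (f : ProbabilityMeasure Vel) : Prop :=
  MemLp (fun v : Vel => v) 2 (f : Measure Vel)

/-- The mean velocity `⟨f⟩ = ∫ v df(v)`. -/
def mean (f : ProbabilityMeasure Vel) : Vel :=
  ∫ v, v ∂(f : Measure Vel)

/-- The kinetic energy (or temperature) `θ(f) = (1/3) ∫ |v - ⟨f⟩|² df(v)`. -/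
def temperature (f : ProbabilityMeasure Vel) : ℝ :=
  (1 / 3) * ∫ v, ‖v - mean f‖ ^ 2 ∂(f : Measure Vel)

/-- `π` is a coupling of `f` and `g`: a joint probability measure with marginals `f` and `g`. -/
def IsCoupling (π : ProbabilityMeasure (Vel × Vel)) (f g : ProbabilityMeasure Vel) : Prop :=
  (π : Measure (Vel × Vel)).map Prod.fst = (f : Measure Vel) ∧
    (π : Measure (Vel × Vel)).map Prod.snd = (g : Measure Vel)

/-- The Euclidean (quadratic) Wasserstein distance
`W₂(f, g) = inf_π (∬ |v - w|² dπ(v, w))^(1/2)`, with values in `[0, ∞]`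
(it is finite on `P₂(ℝ³)`). -/
def W2 (f g : ProbabilityMeasure Vel) : ℝ≥0∞ :=
  ⨅ (π : ProbabilityMeasure (Vel × Vel)) (_ : IsCoupling π f g),
    (∫⁻ z, edist z.1 z.2 ^ 2 ∂(π : Measure (Vel × Vel))) ^ (1 / 2 : ℝ)

/-- The postcollisional velocity
`v' = (v + w)/2 + ((1 - e)/4) (v - w) + ((1 + e)/4) |v - w| σ`. -/
def postVel (e : ℝ) (v w σ : Vel) : Vel :=
  (1 / 2 : ℝ) • (v + w) + ((1 - e) / 4) • (v - w) + ((1 + e) / 4 * ‖v - w‖) • σ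

/-- The surface measure `dσ` of the unit sphere `S²`, of total mass `4π`. -/
def surface : Measure (Metric.sphere (0 : Vel) 1) :=
  (volume : Measure Vel).toSphere

/-- The collision operator in weak form,
`(φ, Q(f, f)) = (1/4π) ∫∫∫_{S²} [φ(v') - φ(v)] dσ df(v) df(w)`. -/
def collision (e : ℝ) (f : ProbabilityMeasure Vel) (φ : Vel → ℝ) : ℝ :=
  (1 / (4 * Real.pi)) *
    ∫ v, ∫ w, ∫ σ, (φ (postVel e v w (σ : Vel)) - φ v) ∂surface ∂(f : Measure Vel)
      ∂(f : Measure Vel)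

/-- The constant `E = 8 / (1 - e²)`. -/
def collisionRate (e : ℝ) : ℝ := 8 / (1 - e ^ 2)

/-- The diffusion coefficient `Θ²(f) = (E A / B) θ(f)^(p - 1/2)`. -/
def diffusivity (e A B p : ℝ) (f : ProbabilityMeasure Vel) : ℝ :=
  collisionRate e * A / B * temperature f ^ (p - 1 / 2)

/-- `f : [0, ∞) → P₂(ℝ³)` is a (measure-valued, weak) solution of
`∂f/∂τ = E Q(f, f) + Θ²(f(τ)) Δf` with initial datum `f₀`. The values of `f` at negative times are
irrelevant.

The curve is continuous for the weak topology of probability measures, the coefficient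
`τ ↦ Θ²(f(τ))` is meaningful at almost every time and locally integrable, and the equation, tested
against an arbitrary smooth compactly supported function, holds in time-integrated form. For such
curves the integrand in `weak_form` is integrable: the collision term and `∫ Δφ df(s)` are
continuous and bounded in `s`. -/
structure IsSolution (e A B p : ℝ) (f₀ : ProbabilityMeasure Vel)
    (f : ℝ → ProbabilityMeasure Vel) : Prop where
  initial : f 0 = f₀
  inP2 : ∀ τ, 0 ≤ τ → InP2 (f τ)
  continuousOn : ContinuousOn f (Ici 0)
  /-- If the exponent `p - 1/2` is negative, the power `θ^(p - 1/2)` requires `θ > 0`. -/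
  diffusivity_defined : p < 1 / 2 → ∀ᵐ τ ∂(volume.restrict (Ioi (0 : ℝ))), 0 < temperature (f τ)
  diffusivity_integrable : ∀ T, 0 ≤ T →
    IntervalIntegrable (fun s => diffusivity e A B p (f s)) volume 0 T
  weak_form : ∀ φ : Vel → ℝ, ContDiff ℝ ∞ φ → HasCompactSupport φ → ∀ τ, 0 ≤ τ →
    ∫ v, φ v ∂(f τ : Measure Vel) = ∫ v, φ v ∂(f₀ : Measure Vel) +
      ∫ s in (0 : ℝ)..τ, (collisionRate e * collision e (f s) φ +
        diffusivity e A B p (f s) * ∫ v, Laplacian.laplacian φ v ∂(f s : Measure Vel))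

end

end InelasticMaxwell

/-!
# Contraction of the driven inelastic Maxwell equation in the Wasserstein distance

Let `γ = (3 + e²) / 4`, so that `E (1 - γ) = 2`. The collision operator splits as
`Q(f, f) = Q⁺(f, f) - f`, where `Q⁺(f, f)` is the law `gain e f` of the postcollisional velocity.
Running two collisions with the same direction `σ` along a coupling of `f` and `g` gives
`W₂²(Q⁺(f, f), Q⁺(g, g)) ≤ γ W₂²(f, g) + (1 - γ) |⟨f⟩ - ⟨g⟩|²` (`wassersteinSq_gain_le`): the
cross terms vanish because `∫ σ dσ = 0`, and `||a| - |b|| ≤ |a - b|` controls the rest.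

Two solutions with the same initial temperature have the same temperature for all times: the
equation implies the closed equation `θ' = -2 θ + 2 Θ²(θ)` (`IsSolution.temperature_balance`), for
which a comparison argument is available (`IsSolution.temperature_le`). Hence the two solutions
diffuse at the same rate, and their accumulated diffusions `H(t) = ∫₀ᵗ Θ²` agree. The mean
velocity is conserved (`IsSolution.mean_eq`). Since no regularity beyond weak continuity is
assumed, these balance laws are derived from the equation tested against `cos (⟨v, k⟩ - a)`, by
letting `k → 0` after rescaling; the integrability in time of the second moment is itself obtained
in this limit, by Fatou's lemma.

On the Fourier side the equation has an integrating factor, which yields Duhamel's formula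
`f(τ) = e^{-Eτ} f⁰ ∗ G(H(τ)) + ∫₀^τ E e^{-E(τ-s)} Q⁺(f(s), f(s)) ∗ G(H(τ) - H(s)) ds`
with Gaussian measures `G` (`IsSolution.duhamel_charFun`): `f(τ)` is a mixture of convolutions with
Gaussians that are common to both solutions. The squared Wasserstein distance is convex, does not
increase under convolution, and is lower semicontinuous; the last property allows the integral to be
replaced by Riemann sums, whose weak convergence follows from Lévy's theorem. Thus any bound `b` for
`W₂²(f₁, f₂)` on `[0, τ]` improves to
`e^{-Eτ} W₂²(f₁⁰, f₂⁰) + ∫₀^τ E e^{-E(τ-s)} (γ b(s) + (1 - γ) M) ds`, `M = |⟨f₁⁰⟩ - ⟨f₂⁰⟩|²`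
(`IsSolution.wassersteinSq_le_of_le`). The right-hand side of the theorem is a fixed point of this
affine map, whose linear part has norm at most `γ < 1`, so iterating from the bound provided by the
second moments converges to it (`IsSolution.wassersteinSq_le`).
-/

namespace InelasticMaxwell

noncomputable section

open scoped RealInnerProductSpace Topology Pointwise
open Filter

/-! ### The uniform probability on the sphere -/

/-- The uniform probability measure `dσ / 4π` on the unit sphere `S²`. -/
def sphereProb : Measure (Metric.sphere (0 : Vel) 1) :=
  ENNReal.ofReal (1 / (4 * Real.pi)) • surface

instance isProbabilityMeasure_sphereProb : IsProbabilityMeasure sphereProb where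
  measure_univ := by
    have h : surface univ = ENNReal.ofReal (4 * Real.pi) := by
      rw [surface, Measure.toSphere_apply_univ, EuclideanSpace.volume_ball_fin_three]
      simp only [finrank_euclideanSpace, Fintype.card_fin]
      rw [ENNReal.ofReal_one, one_pow, one_mul, ← ENNReal.ofReal_natCast,
        ← ENNReal.ofReal_mul (by positivity)]
      congr 1
      push_cast
      ring
    rw [sphereProb, Measure.smul_apply, h, smul_eq_mul, ← ENNReal.ofReal_mul (by positivity)]
    rw [one_div, inv_mul_cancel₀ (by positivity), ENNReal.ofReal_one]

lemma map_neg_surface : surface.map (fun σ => -σ) = surface := by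
  have hc : Continuous (fun σ : Metric.sphere (0 : Vel) 1 => -σ) := by fun_prop
  ext s hs
  rw [Measure.map_apply hc.measurable hs, surface,
    Measure.toSphere_apply' _ (hc.measurable hs), Measure.toSphere_apply' _ hs]
  congr 1
  rw [← Measure.measure_neg volume (Ioo (0 : ℝ) 1 • ((↑) '' s : Set Vel))]
  congr 1
  ext x
  simp only [Set.mem_smul, Set.mem_neg, Set.mem_image, Set.mem_preimage]
  constructor
  · rintro ⟨r, hr, _, ⟨σ, hσ, rfl⟩, rfl⟩
    exact ⟨r, hr, _, ⟨-σ, hσ, rfl⟩, by simp⟩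
  · rintro ⟨r, hr, _, ⟨σ, hσ, rfl⟩, h⟩
    refine ⟨r, hr, _, ⟨-σ, by simpa using hσ, rfl⟩, ?_⟩
    rw [← neg_eq_iff_eq_neg] at h
    simp [← h]

lemma integrable_sphereProb {E : Type*} [NormedAddCommGroup E] {F : Metric.sphere (0 : Vel) 1 → E}
    (hF : Continuous F) : Integrable F sphereProb :=
  hF.integrable_of_hasCompactSupport (HasCompactSupport.of_compactSpace F)

/-- The uniform direction is centred, by invariance of the surface measure under `σ ↦ -σ`. -/
lemma integral_sphereProb_id : ∫ σ, (σ : Vel) ∂sphereProb = 0 := by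
  have h : ∫ σ, (σ : Vel) ∂surface = - ∫ σ, (σ : Vel) ∂surface := by
    conv_lhs => rw [← map_neg_surface]
    rw [integral_map (by fun_prop) (by fun_prop), ← integral_neg]
    simp
  rw [sphereProb, integral_smul_measure, show ∫ σ, (σ : Vel) ∂surface = 0 by
    simpa [eq_neg_iff_add_eq_zero, ← two_smul ℝ] using h, smul_zero]

lemma integral_sphereProb_normSq (x : Vel) (r : ℝ) :
    ∫ σ, ‖x + r • (σ : Vel)‖ ^ 2 ∂sphereProb = ‖x‖ ^ 2 + r ^ 2 := by
  have h1 : ∀ σ : Metric.sphere (0 : Vel) 1,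
      ‖x + r • (σ : Vel)‖ ^ 2 = (‖x‖ ^ 2 + r ^ 2) + 2 * r * ⟪x, (σ : Vel)⟫ := by
    intro σ
    have hσ : ‖(σ : Vel)‖ = 1 := by simp
    rw [norm_add_sq_real, inner_smul_right, norm_smul, hσ, mul_one, Real.norm_eq_abs, sq_abs]
    ring
  simp_rw [h1]
  rw [integral_add (integrable_const _) (integrable_sphereProb (by fun_prop)), integral_const_mul,
    integral_inner (integrable_sphereProb (by fun_prop)), integral_sphereProb_id]
  simp

/-! ### The gain operator -/

lemma postVel_eq (e : ℝ) (v w σ : Vel) :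
    postVel e v w σ =
      (((3 - e) / 4) • v + ((1 + e) / 4) • w) + ((1 + e) / 4 * ‖v - w‖) • σ := by
  rw [postVel]
  module

@[fun_prop]
lemma continuous_postVel {X : Type*} [TopologicalSpace X] (e : ℝ) {a b c : X → Vel}
    (ha : Continuous a) (hb : Continuous b) (hc : Continuous c) :
    Continuous (fun x => postVel e (a x) (b x) (c x)) := by
  unfold postVel
  fun_prop

/-- The postcollisional velocity as a function of the triple `(v, w, σ)`. -/
def collide (e : ℝ) (x : Vel × Vel × Metric.sphere (0 : Vel) 1) : Vel :=
  postVel e x.1 x.2.1 x.2.2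

lemma continuous_collide (e : ℝ) : Continuous (collide e) := by
  unfold collide
  fun_prop

/-- The gain part `Q⁺(f, f)` of the collision operator: the law of the postcollisional velocity
when `v`, `w` are independent with law `f` and `σ` is uniform on the sphere. -/
def gain (e : ℝ) (f : ProbabilityMeasure Vel) : ProbabilityMeasure Vel :=
  (f.prod (f.prod ⟨sphereProb, inferInstance⟩)).map (continuous_collide e).measurable.aemeasurable

lemma coe_gain (e : ℝ) (f : ProbabilityMeasure Vel) :
    (gain e f : Measure Vel) =
      ((f : Measure Vel).prod ((f : Measure Vel).prod sphereProb)).map (collide e) := rfl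

lemma continuous_gain (e : ℝ) : Continuous (gain e) := by
  have h := ProbabilityMeasure.continuous_map (continuous_collide e)
  refine h.comp (?_ : Continuous fun f : ProbabilityMeasure Vel => f.prod (f.prod _))
  fun_prop

lemma integral_gain {E : Type*} [NormedAddCommGroup E] [NormedSpace ℝ E] (e : ℝ)
    (f : ProbabilityMeasure Vel) {φ : Vel → E} (hφ : Continuous φ)
    (hi : Integrable φ (gain e f : Measure Vel)) :
    ∫ v, φ v ∂(gain e f : Measure Vel) =
      ∫ v, ∫ w, ∫ σ, φ (postVel e v w (σ : Vel)) ∂sphereProb ∂(f : Measure Vel)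
        ∂(f : Measure Vel) := by
  have hm : AEMeasurable (collide e)
    ((f : Measure Vel).prod ((f : Measure Vel).prod sphereProb)) :=
    (continuous_collide e).aemeasurable
  have hφm : AEStronglyMeasurable φ
      (((f : Measure Vel).prod ((f : Measure Vel).prod sphereProb)).map (collide e)) :=
    hφ.aestronglyMeasurable
  rw [coe_gain] at hi ⊢
  rw [integral_map hm hφm]
  rw [integrable_map_measure hφm hm] at hi
  refine (integral_prod _ hi).trans (integral_congr_ae ?_)
  filter_upwards [hi.prod_right_ae] with v hv
  exact integral_prod _ hv

/-- Against bounded continuous functions the collision operator is the gain minus the loss term. -/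
lemma collision_eq (e : ℝ) (f : ProbabilityMeasure Vel) {φ : Vel → ℝ} (hφ : Continuous φ)
    {C : ℝ} (hC : ∀ v, |φ v| ≤ C) :
    collision e f φ = ∫ v, φ v ∂(gain e f : Measure Vel) - ∫ v, φ v ∂(f : Measure Vel) := by
  have hb : ∀ μ : ProbabilityMeasure Vel, Integrable φ (μ : Measure Vel) := fun μ =>
    Integrable.of_bound hφ.aestronglyMeasurable C (ae_of_all _ fun v => by simpa using hC v)
  have hp : Integrable (fun x : Vel × Vel × Metric.sphere (0 : Vel) 1 => φ (collide e x))
      ((f : Measure Vel).prod ((f : Measure Vel).prod sphereProb)) :=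
    Integrable.of_bound (hφ.comp (continuous_collide e)).aestronglyMeasurable C
      (ae_of_all _ fun v => by simpa using hC _)
  have hscale : ∀ F : Metric.sphere (0 : Vel) 1 → ℝ,
      1 / (4 * Real.pi) * ∫ σ, F σ ∂surface = ∫ σ, F σ ∂sphereProb := by
    intro F
    rw [sphereProb, integral_smul_measure, ENNReal.toReal_ofReal (by positivity), smul_eq_mul]
  have hq : Integrable (fun x : Vel × Vel × Metric.sphere (0 : Vel) 1 => φ x.1)
      ((f : Measure Vel).prod ((f : Measure Vel).prod sphereProb)) :=
    Integrable.of_bound (hφ.comp continuous_fst).aestronglyMeasurable C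
      (ae_of_all _ fun v => by simpa using hC _)
  have hfst : ∫ x, φ x.1 ∂((f : Measure Vel).prod ((f : Measure Vel).prod sphereProb)) =
      ∫ v, φ v ∂(f : Measure Vel) := by
    rw [integral_fun_fst]
    simp
  have hpq : Integrable (fun x : Vel × Vel × Metric.sphere (0 : Vel) 1 => φ (collide e x) - φ x.1)
      ((f : Measure Vel).prod ((f : Measure Vel).prod sphereProb)) := hp.sub hq
  rw [coe_gain, integral_map (continuous_collide e).aemeasurable hφ.aestronglyMeasurable, ← hfst,
    ← integral_sub hp hq, integral_prod _ hpq, collision, ← integral_const_mul]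
  refine integral_congr_ae ?_
  filter_upwards [hpq.prod_right_ae] with v hv
  rw [integral_prod _ hv, ← integral_const_mul]
  exact integral_congr_ae (ae_of_all _ fun w => hscale _)

/-! ### Moments -/

/-- The second moment `∫ |v|² df(v)`. -/
def secondMoment (f : ProbabilityMeasure Vel) : ℝ :=
  ∫ v, ‖v‖ ^ 2 ∂(f : Measure Vel)

lemma InP2.integrable {f : ProbabilityMeasure Vel} (hf : InP2 f) :
    Integrable (fun v : Vel => v) (f : Measure Vel) :=
  MemLp.integrable one_le_two hf

lemma InP2.integrable_normSq {f : ProbabilityMeasure Vel} (hf : InP2 f) :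
    Integrable (fun v : Vel => ‖v‖ ^ 2) (f : Measure Vel) :=
  MemLp.integrable_norm_pow hf two_ne_zero

lemma temperature_eq {f : ProbabilityMeasure Vel} (hf : InP2 f) :
    temperature f = (1 / 3) * (secondMoment f - ‖mean f‖ ^ 2) := by
  have h : ∀ v : Vel, ‖v - mean f‖ ^ 2 = ‖v‖ ^ 2 - 2 * ⟪mean f, v⟫ + ‖mean f‖ ^ 2 := by
    intro v
    rw [norm_sub_sq_real, real_inner_comm]
  have hi : Integrable (fun v : Vel => 2 * ⟪mean f, v⟫) (f : Measure Vel) :=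
    (hf.integrable.const_inner _).const_mul 2
  have hs : Integrable (fun v : Vel => ‖v‖ ^ 2 - 2 * ⟪mean f, v⟫) (f : Measure Vel) :=
    hf.integrable_normSq.sub hi
  rw [temperature]
  simp_rw [h]
  rw [integral_add hs (integrable_const _),
    integral_sub hf.integrable_normSq hi, integral_const_mul, integral_inner hf.integrable,
    ← mean, real_inner_self_eq_norm_sq, secondMoment]
  simp
  ring

lemma temperature_nonneg (f : ProbabilityMeasure Vel) : 0 ≤ temperature f :=
  mul_nonneg (by norm_num) (integral_nonneg fun _ => by positivity)

lemma secondMoment_nonneg (f : ProbabilityMeasure Vel) : 0 ≤ secondMoment f :=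
  integral_nonneg fun _ => by positivity

/-- The average over two independent copies of the quadratic form which governs both the energy of
the gain term and the cost of a synchronous coupling. The coefficient of `‖∫ ζ‖²` is
`(1 - e²) / 4`. -/
lemma integral_integral_collision_form {Ω : Type*} [MeasurableSpace Ω] (μ : Measure Ω)
    [IsProbabilityMeasure μ] (e : ℝ) {ζ : Ω → Vel} (hζ : MemLp ζ 2 μ) :
    ∫ z, ∫ z', (‖((3 - e) / 4) • ζ z + ((1 + e) / 4) • ζ z'‖ ^ 2 +
        ((1 + e) / 4 * ‖ζ z - ζ z'‖) ^ 2) ∂μ ∂μ =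
      (3 + e ^ 2) / 4 * ∫ z, ‖ζ z‖ ^ 2 ∂μ + (1 - e ^ 2) / 4 * ‖∫ z, ζ z ∂μ‖ ^ 2 := by
  have h1 : Integrable ζ μ := hζ.integrable one_le_two
  have h2 : Integrable (fun z => ‖ζ z‖ ^ 2) μ := MemLp.integrable_norm_pow hζ two_ne_zero
  have hpt : ∀ z z', ‖((3 - e) / 4) • ζ z + ((1 + e) / 4) • ζ z'‖ ^ 2 +
      ((1 + e) / 4 * ‖ζ z - ζ z'‖) ^ 2 =
      (((3 - e) / 4) ^ 2 + ((1 + e) / 4) ^ 2) * ‖ζ z‖ ^ 2 +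
        (2 * ((1 + e) / 4) ^ 2 * ‖ζ z'‖ ^ 2 + (1 - e ^ 2) / 4 * ⟪ζ z, ζ z'⟫) := by
    intro z z'
    rw [mul_pow, norm_add_sq_real, norm_sub_sq_real, norm_smul, norm_smul, real_inner_smul_left,
      real_inner_smul_right, mul_pow, mul_pow, Real.norm_eq_abs, Real.norm_eq_abs, sq_abs, sq_abs]
    ring
  have hin : ∀ z, ∫ z', (‖((3 - e) / 4) • ζ z + ((1 + e) / 4) • ζ z'‖ ^ 2 +
        ((1 + e) / 4 * ‖ζ z - ζ z'‖) ^ 2) ∂μ =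
      (((3 - e) / 4) ^ 2 + ((1 + e) / 4) ^ 2) * ‖ζ z‖ ^ 2 +
        (2 * ((1 + e) / 4) ^ 2 * ∫ z', ‖ζ z'‖ ^ 2 ∂μ +
          (1 - e ^ 2) / 4 * ⟪∫ z', ζ z' ∂μ, ζ z⟫) := by
    intro z
    simp_rw [hpt]
    rw [integral_add (integrable_const _)
        ((h2.const_mul _).fun_add ((h1.const_inner _).const_mul _)),
      integral_add (h2.const_mul _) ((h1.const_inner _).const_mul _), integral_const_mul,
      integral_const_mul, integral_const_mul, integral_inner h1, real_inner_comm]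
    simp
  simp_rw [hin]
  rw [integral_add (h2.const_mul _)
      ((integrable_const _).fun_add ((h1.const_inner _).const_mul _)),
    integral_add (integrable_const _) ((h1.const_inner _).const_mul _), integral_const_mul,
    integral_const_mul, integral_const_mul, integral_inner h1, real_inner_self_eq_norm_sq]
  simp
  ring

lemma inP2_gain {e : ℝ} {f : ProbabilityMeasure Vel} (hf : InP2 f) : InP2 (gain e f) := by
  rw [InP2, coe_gain, memLp_map_measure_iff (by fun_prop) (continuous_collide e).aemeasurable]
  have h1 : MemLp (fun x : Vel × Vel × Metric.sphere (0 : Vel) 1 => x.1) 2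
      ((f : Measure Vel).prod ((f : Measure Vel).prod sphereProb)) :=
    hf.comp_measurePreserving measurePreserving_fst
  have h2 : MemLp (fun x : Vel × Vel × Metric.sphere (0 : Vel) 1 => x.2.1) 2
      ((f : Measure Vel).prod ((f : Measure Vel).prod sphereProb)) :=
    hf.comp_measurePreserving (measurePreserving_fst.comp measurePreserving_snd)
  have hσ := fun σ : Metric.sphere (0 : Vel) 1 => (by simp : ‖(σ : Vel)‖ = 1)
  refine (((h1.const_smul ((3 - e) / 4)).add (h2.const_smul ((1 + e) / 4))).norm.add
    ((h1.sub h2).norm.const_mul |(1 + e) / 4|)).mono'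
    (continuous_collide e).aestronglyMeasurable (ae_of_all _ fun x => ?_)
  simp only [Function.comp, collide, postVel_eq, Pi.add_apply, Pi.smul_apply, Pi.sub_apply]
  refine (norm_add_le _ _).trans ?_
  rw [norm_smul _ (x.2.2 : Vel), hσ, norm_mul, norm_norm, mul_one, Real.norm_eq_abs]

lemma mean_gain (e : ℝ) {f : ProbabilityMeasure Vel} (hf : InP2 f) :
    mean (gain e f) = mean f := by
  have hin : ∀ v w : Vel, ∫ σ : Metric.sphere (0 : Vel) 1, postVel e v w (σ : Vel) ∂sphereProb =
      ((3 - e) / 4) • v + ((1 + e) / 4) • w := by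
    intro v w
    simp_rw [postVel_eq]
    rw [integral_add (integrable_const _) (integrable_sphereProb (by fun_prop)), integral_smul,
      integral_sphereProb_id]
    simp
  have hi := hf.integrable
  rw [mean, integral_gain e f (φ := fun v => v) continuous_id (inP2_gain hf).integrable]
  simp_rw [hin]
  have hin2 : ∀ v : Vel, ∫ w, (((3 - e) / 4) • v + ((1 + e) / 4) • w) ∂(f : Measure Vel) =
      ((3 - e) / 4) • v + ((1 + e) / 4) • mean f := by
    intro v
    rw [integral_add (integrable_const _) (hi.fun_smul _), integral_smul, integral_smul,
      show ∫ v, v ∂(f : Measure Vel) = mean f from rfl]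
    simp
  simp_rw [hin2]
  rw [integral_add (hi.fun_smul _) (integrable_const _), integral_smul,
    show ∫ v, v ∂(f : Measure Vel) = mean f from rfl]
  simp only [integral_const, probReal_univ, one_smul]
  module

/-- Collisions contract the second moment towards the squared mean: energy is dissipated. -/
lemma secondMoment_gain (e : ℝ) {f : ProbabilityMeasure Vel} (hf : InP2 f) :
    secondMoment (gain e f) =
      (3 + e ^ 2) / 4 * secondMoment f + (1 - e ^ 2) / 4 * ‖mean f‖ ^ 2 := by
  rw [secondMoment, integral_gain e f (by fun_prop) (inP2_gain hf).integrable_normSq]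
  simp_rw [postVel_eq, integral_sphereProb_normSq]
  exact integral_integral_collision_form (f : Measure Vel) e hf

/-! ### The squared Wasserstein distance -/

/-- The measure `π` on the product has marginals `μ` and `ν`. No normalization is required, so that
the notion is stable under sums and multiples. -/
def HasMarginals (π : Measure (Vel × Vel)) (μ ν : Measure Vel) : Prop :=
  π.map Prod.fst = μ ∧ π.map Prod.snd = ν

/-- The quadratic cost `∬ |v - w|² dπ(v, w)`. -/
def cost (π : Measure (Vel × Vel)) : ℝ≥0∞ :=
  ∫⁻ z, edist z.1 z.2 ^ 2 ∂π

/-- The squared Wasserstein distance, for arbitrary measures; for probability measures it is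
`W2 ^ 2`. It is `⊤` if the two measures have different masses. -/
def wassersteinSq (μ ν : Measure Vel) : ℝ≥0∞ :=
  ⨅ (π : Measure (Vel × Vel)) (_ : HasMarginals π μ ν), cost π

lemma wassersteinSq_le {π : Measure (Vel × Vel)} {μ ν : Measure Vel} (h : HasMarginals π μ ν) :
    wassersteinSq μ ν ≤ cost π :=
  iInf₂_le π h

lemma HasMarginals.isProbabilityMeasure {π : Measure (Vel × Vel)} {μ ν : Measure Vel}
    [IsProbabilityMeasure μ] (h : HasMarginals π μ ν) : IsProbabilityMeasure π := by
  constructor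
  have h1 := measure_univ (μ := μ)
  rwa [← h.1, Measure.map_apply measurable_fst MeasurableSet.univ, preimage_univ] at h1

lemma W2_sq (f g : ProbabilityMeasure Vel) :
    W2 f g ^ 2 = wassersteinSq (f : Measure Vel) (g : Measure Vel) := by
  have hpow : ∀ x : ℝ≥0∞, (x ^ (1 / 2 : ℝ)) ^ 2 = x := fun x => by
    rw [← ENNReal.rpow_natCast, ← ENNReal.rpow_mul]
    norm_num
  have hpow' : ∀ x : ℝ≥0∞, (x ^ 2) ^ (1 / 2 : ℝ) = x := fun x => by
    rw [← ENNReal.rpow_natCast, ← ENNReal.rpow_mul]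
    norm_num
  apply le_antisymm
  · refine le_iInf₂ fun π hπ => ?_
    have hp := hπ.isProbabilityMeasure
    calc W2 f g ^ 2 ≤ ((cost π) ^ (1 / 2 : ℝ)) ^ 2 := by
          gcongr
          exact iInf₂_le (⟨π, hp⟩ : ProbabilityMeasure (Vel × Vel)) hπ
      _ = cost π := hpow _
  · have h : (wassersteinSq (f : Measure Vel) (g : Measure Vel)) ^ (1 / 2 : ℝ) ≤ W2 f g := by
      refine le_iInf₂ fun π hπ => ENNReal.rpow_le_rpow (wassersteinSq_le hπ) (by norm_num)
    calc _ = ((wassersteinSq (f : Measure Vel) (g : Measure Vel)) ^ (1 / 2 : ℝ)) ^ 2 :=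
          (hpow _).symm
      _ ≤ _ := by gcongr

/-- Subadditivity: the sum of two couplings is a coupling of the sums. -/
lemma wassersteinSq_add_le (μ μ' ν ν' : Measure Vel) :
    wassersteinSq (μ + μ') (ν + ν') ≤ wassersteinSq μ ν + wassersteinSq μ' ν' := by
  simp only [wassersteinSq, ENNReal.iInf_add, ENNReal.add_iInf]
  refine le_iInf₂ fun π' hπ' => le_iInf₂ fun π hπ => ?_
  refine (iInf₂_le (π + π') ⟨?_, ?_⟩).trans_eq
    (lintegral_add_measure (fun z : Vel × Vel => edist z.1 z.2 ^ 2) π π')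
  · rw [Measure.map_add _ _ measurable_fst, hπ.1, hπ'.1]
  · rw [Measure.map_add _ _ measurable_snd, hπ.2, hπ'.2]

lemma wassersteinSq_zero : wassersteinSq 0 0 = 0 := by
  refine le_antisymm ((wassersteinSq_le (π := 0) ⟨by simp, by simp⟩).trans_eq ?_) zero_le
  simp [cost]

/-- The hypothesis `c ≠ 0` matters: the infimum on the right is `⊤` if there is no coupling. -/
lemma mul_wassersteinSq {c : ℝ≥0∞} (h0 : c ≠ 0) (hc : c ≠ ⊤) (μ ν : Measure Vel) :
    c * wassersteinSq μ ν =
      ⨅ (π : Measure (Vel × Vel)) (_ : HasMarginals π μ ν), c * cost π := by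
  simp only [wassersteinSq]
  rw [ENNReal.mul_iInf_of_ne h0 hc]
  exact iInf_congr fun π => ENNReal.mul_iInf_of_ne h0 hc

lemma wassersteinSq_smul_le {c : ℝ≥0∞} (hc : c ≠ ⊤) (μ ν : Measure Vel) :
    wassersteinSq (c • μ) (c • ν) ≤ c * wassersteinSq μ ν := by
  rcases eq_or_ne c 0 with rfl | h0
  · simp [wassersteinSq_zero]
  rw [mul_wassersteinSq h0 hc]
  refine le_iInf₂ fun π hπ => ?_
  refine (iInf₂_le (c • π) ⟨?_, ?_⟩).trans_eq (lintegral_smul_measure _ _)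
  · rw [Measure.map_smul, hπ.1]
  · rw [Measure.map_smul, hπ.2]

/-- Convexity of the squared Wasserstein distance along finite mixtures. -/
lemma wassersteinSq_sum_le {ι : Type*} (s : Finset ι) {c : ι → ℝ≥0∞} (hc : ∀ i, c i ≠ ⊤)
    (μ ν : ι → Measure Vel) :
    wassersteinSq (∑ i ∈ s, c i • μ i) (∑ i ∈ s, c i • ν i) ≤
      ∑ i ∈ s, c i * wassersteinSq (μ i) (ν i) := by
  classical
  induction s using Finset.induction_on with
  | empty => simp [wassersteinSq_zero]
  | insert i s hi ih =>
    rw [Finset.sum_insert hi, Finset.sum_insert hi, Finset.sum_insert hi]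
    exact (wassersteinSq_add_le _ _ _ _).trans (add_le_add (wassersteinSq_smul_le (hc i) _ _) ih)

/-- Convolution with a fixed probability measure does not increase the Wasserstein distance. -/
lemma wassersteinSq_conv_le (μ ν γ : Measure Vel) [IsProbabilityMeasure μ]
    [IsProbabilityMeasure ν] [IsProbabilityMeasure γ] :
    wassersteinSq (μ ∗ γ) (ν ∗ γ) ≤ wassersteinSq μ ν := by
  refine le_iInf₂ fun π hπ => ?_
  have hp := hπ.isProbabilityMeasure
  have hS : Measurable (fun x : (Vel × Vel) × Vel => (x.1.1 + x.2, x.1.2 + x.2)) := by fun_prop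
  refine (wassersteinSq_le (π := (π.prod γ).map
    (fun x : (Vel × Vel) × Vel => (x.1.1 + x.2, x.1.2 + x.2))) ⟨?_, ?_⟩).trans_eq ?_
  · rw [Measure.map_map measurable_fst hS, ← hπ.1, Measure.conv,
      ← Measure.map_id (μ := γ), Measure.map_prod_map _ _ measurable_fst measurable_id,
      Measure.map_map (by fun_prop) (by fun_prop), Measure.map_id]
    rfl
  · rw [Measure.map_map measurable_snd hS, ← hπ.2, Measure.conv,
      ← Measure.map_id (μ := γ), Measure.map_prod_map _ _ measurable_snd measurable_id,
      Measure.map_map (by fun_prop) (by fun_prop), Measure.map_id]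
    rfl
  · rw [cost, lintegral_map (by fun_prop) hS]
    simp only [edist_add_right]
    have : ∫⁻ x : (Vel × Vel) × Vel, edist x.1.1 x.1.2 ^ 2 ∂(π.prod γ) =
      ∫⁻ z, edist z.1 z.2 ^ 2 ∂((π.prod γ).map Prod.fst) := by
      rw [lintegral_map (by fun_prop) measurable_fst]
    rw [this, Measure.map_fst_prod]
    simp [cost]

/-- Lower semicontinuity of the squared Wasserstein distance for the weak topology: near-optimal
couplings form a tight family, and by Prokhorov's theorem have a limit point, which couples the
limits. -/
lemma wassersteinSq_le_of_tendsto {μ ν : ℕ → ProbabilityMeasure Vel}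
    {μ₀ ν₀ : ProbabilityMeasure Vel} (hμ : Tendsto μ atTop (𝓝 μ₀)) (hν : Tendsto ν atTop (𝓝 ν₀))
    {c : ℕ → ℝ} {c₀ : ℝ} (hc : Tendsto c atTop (𝓝 c₀))
    (h : ∀ n, wassersteinSq (μ n : Measure Vel) (ν n : Measure Vel) ≤ ENNReal.ofReal (c n)) :
    wassersteinSq (μ₀ : Measure Vel) (ν₀ : Measure Vel) ≤ ENNReal.ofReal c₀ := by
  have hex : ∀ n : ℕ, ∃ π : ProbabilityMeasure (Vel × Vel),
      HasMarginals (π : Measure (Vel × Vel)) (μ n) (ν n) ∧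
        cost (π : Measure (Vel × Vel)) < ENNReal.ofReal (c n) + ENNReal.ofReal (1 / (n + 1)) := by
    intro n
    have hlt := (h n).trans_lt (ENNReal.lt_add_right ENNReal.ofReal_ne_top
      (ENNReal.ofReal_pos.2 (Nat.one_div_pos_of_nat (α := ℝ) (n := n))).ne')
    simp only [wassersteinSq, iInf_lt_iff] at hlt
    obtain ⟨π, hπ, hlt⟩ := hlt
    exact ⟨⟨π, hπ.isProbabilityMeasure⟩, hπ, hlt⟩
  choose π hπ hcost using hex
  have htight : IsTightMeasureSet
      {((ρ : ProbabilityMeasure (Vel × Vel)) : Measure (Vel × Vel)) | ρ ∈ range π} := by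
    have hseq : ∀ {η : ℕ → ProbabilityMeasure Vel} {η₀ : ProbabilityMeasure Vel},
        Tendsto η atTop (𝓝 η₀) → IsTightMeasureSet (range fun n => (η n : Measure Vel)) :=
      fun {η η₀} hη => isTightMeasureSet_of_tendsto_charFun
        (f := charFun (η₀ : Measure Vel)) (by fun_prop)
        (ProbabilityMeasure.tendsto_iff_tendsto_charFun.1 hη)
    apply IsTightMeasureSet.prodMk
    · refine (hseq hμ).subset ?_
      rintro _ ⟨_, ⟨_, ⟨n, rfl⟩, rfl⟩, rfl⟩
      exact ⟨n, (hπ n).1.symm⟩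
    · refine (hseq hν).subset ?_
      rintro _ ⟨_, ⟨_, ⟨n, rfl⟩, rfl⟩, rfl⟩
      exact ⟨n, (hπ n).2.symm⟩
  have hcpt := isCompact_closure_of_isTightMeasureSet htight
  obtain ⟨ρ, -, ψ, hψ, hlim⟩ := hcpt.tendsto_subseq (x := π) fun n => subset_closure ⟨n, rfl⟩
  have hmarg : HasMarginals (ρ : Measure (Vel × Vel)) μ₀ ν₀ := by
    constructor
    · have h1 := (ProbabilityMeasure.continuous_map (f := (Prod.fst : Vel × Vel → Vel))
        continuous_fst).continuousAt.tendsto.comp hlim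
      have h2 : ∀ n, (π n).map measurable_fst.aemeasurable = μ n :=
        fun n => Subtype.ext (hπ n).1
      have h3 := tendsto_nhds_unique (h1.congr fun n => h2 (ψ n)) (hμ.comp hψ.tendsto_atTop)
      exact congrArg ProbabilityMeasure.toMeasure h3
    · have h1 := (ProbabilityMeasure.continuous_map (f := (Prod.snd : Vel × Vel → Vel))
        continuous_snd).continuousAt.tendsto.comp hlim
      have h2 : ∀ n, (π n).map measurable_snd.aemeasurable = ν n :=
        fun n => Subtype.ext (hπ n).2
      have h3 := tendsto_nhds_unique (h1.congr fun n => h2 (ψ n)) (hν.comp hψ.tendsto_atTop)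
      exact congrArg ProbabilityMeasure.toMeasure h3
  refine (wassersteinSq_le hmarg).trans ?_
  have hcost_eq : ∀ ρ : Measure (Vel × Vel), cost ρ =
      ∫⁻ z, ENNReal.ofReal (‖z.1 - z.2‖ ^ 2) ∂ρ := by
    intro ρ
    refine lintegral_congr fun z => ?_
    rw [edist_dist, dist_eq_norm, ENNReal.ofReal_pow (norm_nonneg _)]
  rw [hcost_eq]
  refine (lintegral_le_liminf_lintegral_of_forall_isOpen_measure_le_liminf_measure
    (f := fun z : Vel × Vel => ‖z.1 - z.2‖ ^ 2) (by fun_prop) (fun _ => by positivity)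
    fun G hG => ProbabilityMeasure.le_liminf_measure_open_of_tendsto hlim hG).trans ?_
  have hcs : Tendsto (fun n => ENNReal.ofReal (c (ψ n)) + ENNReal.ofReal (1 / ((ψ n : ℕ) + 1)))
      atTop (𝓝 (ENNReal.ofReal c₀ + 0)) := by
    refine Tendsto.add ?_ ?_
    · exact (ENNReal.continuous_ofReal.tendsto _).comp (hc.comp hψ.tendsto_atTop)
    · have := (ENNReal.continuous_ofReal.tendsto _).comp
        ((tendsto_one_div_add_atTop_nhds_zero_nat (𝕜 := ℝ)).comp hψ.tendsto_atTop)
      simpa using! this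
  rw [add_zero] at hcs
  rw [← hcs.liminf_eq]
  refine liminf_le_liminf (Eventually.of_forall fun n => ?_)
  have := (hcost (ψ n)).le
  rwa [hcost_eq] at this

/-! ### Contraction by the gain operator -/

/-- The joint postcollisional velocities of two pairs `(v, w)`, `(v', w')` under the same `σ`. -/
def collidePair (e : ℝ) (x : (Vel × Vel) × (Vel × Vel) × Metric.sphere (0 : Vel) 1) : Vel × Vel :=
  (collide e (x.1.1, x.2.1.1, x.2.2), collide e (x.1.2, x.2.1.2, x.2.2))

lemma continuous_collidePair (e : ℝ) : Continuous (collidePair e) := by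
  unfold collidePair
  have := continuous_collide e
  fun_prop

/-- The synchronous coupling of the gain terms: two independent copies of a coupling of `f` and `g`
collide with a common direction `σ`. -/
lemma hasMarginals_collidePair (e : ℝ) {f g : ProbabilityMeasure Vel} {π : Measure (Vel × Vel)}
    [IsProbabilityMeasure π] (hπ : HasMarginals π f g) :
    HasMarginals ((π.prod (π.prod sphereProb)).map (collidePair e)) (gain e f) (gain e g) := by
  have hc := continuous_collide e
  have hp := continuous_collidePair e
  constructor
  · rw [Measure.map_map measurable_fst hp.measurable, coe_gain, ← hπ.1]
    conv_rhs => rw [← Measure.map_id (μ := sphereProb)]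
    rw [Measure.map_prod_map _ _ measurable_fst measurable_id,
      Measure.map_prod_map _ _ measurable_fst (by fun_prop),
      Measure.map_map hc.measurable (by fun_prop)]
    rfl
  · rw [Measure.map_map measurable_snd hp.measurable, coe_gain, ← hπ.2]
    conv_rhs => rw [← Measure.map_id (μ := sphereProb)]
    rw [Measure.map_prod_map _ _ measurable_snd measurable_id,
      Measure.map_prod_map _ _ measurable_snd (by fun_prop),
      Measure.map_map hc.measurable (by fun_prop)]
    rfl

/-- Averaged over a common direction `σ`, the squared distance of two postcollisional velocities is
at most a quadratic form in the differences of the precollisional ones, since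
`∫ σ dσ = 0` and `||a| - |b|| ≤ |a - b|`. -/
lemma integral_normSq_postVel_sub_le (e : ℝ) (v w v' w' : Vel) :
    ∫ σ : Metric.sphere (0 : Vel) 1,
        ‖postVel e v w (σ : Vel) - postVel e v' w' (σ : Vel)‖ ^ 2 ∂sphereProb ≤
      ‖((3 - e) / 4) • (v - v') + ((1 + e) / 4) • (w - w')‖ ^ 2 +
        ((1 + e) / 4 * ‖(v - v') - (w - w')‖) ^ 2 := by
  have h : ∀ σ : Metric.sphere (0 : Vel) 1,
      postVel e v w (σ : Vel) - postVel e v' w' (σ : Vel) =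
        (((3 - e) / 4) • (v - v') + ((1 + e) / 4) • (w - w')) +
          ((1 + e) / 4 * (‖v - w‖ - ‖v' - w'‖)) • (σ : Vel) := by
    intro σ
    rw [postVel_eq, postVel_eq]
    module
  simp_rw [h, integral_sphereProb_normSq, mul_pow]
  have h2 : (‖v - w‖ - ‖v' - w'‖) ^ 2 ≤ ‖(v - v') - (w - w')‖ ^ 2 := by
    rw [sub_sub_sub_comm]
    exact sq_le_sq' (by have := norm_sub_norm_le (v' - w') (v - w)
                        rw [norm_sub_rev (v' - w')] at this; linarith) (norm_sub_norm_le _ _)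
  gcongr

lemma memLp_sub_of_hasMarginals {f g : ProbabilityMeasure Vel} (hf : InP2 f) (hg : InP2 g)
    {π : Measure (Vel × Vel)} (hπ : HasMarginals π f g) :
    MemLp (fun z : Vel × Vel => z.1 - z.2) 2 π := by
  have h1 : MemLp (fun z : Vel × Vel => z.1) 2 π :=
    MemLp.comp_measurePreserving (g := fun v : Vel => v) hf ⟨measurable_fst, hπ.1⟩
  have h2 : MemLp (fun z : Vel × Vel => z.2) 2 π :=
    MemLp.comp_measurePreserving (g := fun v : Vel => v) hg ⟨measurable_snd, hπ.2⟩
  exact h1.sub h2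

lemma integral_sub_of_hasMarginals {f g : ProbabilityMeasure Vel} (hf : InP2 f) (hg : InP2 g)
    {π : Measure (Vel × Vel)} (hπ : HasMarginals π f g) :
    ∫ z, (z.1 - z.2) ∂π = mean f - mean g := by
  have h1 : Integrable (fun z : Vel × Vel => z.1) π :=
    (MeasurePreserving.mk measurable_fst hπ.1).integrable_comp_of_integrable hf.integrable
  have h2 : Integrable (fun z : Vel × Vel => z.2) π :=
    (MeasurePreserving.mk measurable_snd hπ.2).integrable_comp_of_integrable hg.integrable
  rw [integral_sub h1 h2, mean, mean, ← hπ.1, ← hπ.2, integral_map (by fun_prop) (by fun_prop),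
    integral_map (by fun_prop) (by fun_prop)]

lemma cost_eq_integral {π : Measure (Vel × Vel)}
    (h : MemLp (fun z : Vel × Vel => z.1 - z.2) 2 π) :
    cost π = ENNReal.ofReal (∫ z, ‖z.1 - z.2‖ ^ 2 ∂π) := by
  rw [ofReal_integral_eq_lintegral_ofReal (h.integrable_norm_pow two_ne_zero)
    (ae_of_all _ fun _ => by positivity), cost]
  refine lintegral_congr fun z => ?_
  rw [edist_dist, dist_eq_norm, ENNReal.ofReal_pow (norm_nonneg _)]

lemma integrable_collision_form {Ω : Type*} [MeasurableSpace Ω] {μ : Measure Ω} (e : ℝ)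
    {A B : Ω → Vel} (hA : MemLp A 2 μ) (hB : MemLp B 2 μ) :
    Integrable (fun y => ‖((3 - e) / 4) • A y + ((1 + e) / 4) • B y‖ ^ 2 +
      ((1 + e) / 4 * ‖A y - B y‖) ^ 2) μ := by
  have h1 : Integrable (fun y => ‖((3 - e) / 4) • A y + ((1 + e) / 4) • B y‖ ^ 2) μ :=
    MemLp.integrable_norm_pow (p := 2)
      ((hA.const_smul ((3 - e) / 4)).add (hB.const_smul ((1 + e) / 4))) two_ne_zero
  have h2 : Integrable (fun y => ((1 + e) / 4) ^ 2 * ‖A y - B y‖ ^ 2) μ :=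
    (MemLp.integrable_norm_pow (p := 2) (hA.sub hB) two_ne_zero).const_mul _
  simp_rw [mul_pow]
  exact h1.add h2

/-- The gain operator contracts the squared Wasserstein distance, up to the contribution of the
means. The synchronous coupling provides the bound. -/
lemma wassersteinSq_gain_le {e : ℝ} (he1 : e ^ 2 ≤ 1) {f g : ProbabilityMeasure Vel}
    (hf : InP2 f) (hg : InP2 g) :
    wassersteinSq (gain e f : Measure Vel) (gain e g : Measure Vel) ≤
      ENNReal.ofReal ((3 + e ^ 2) / 4) * wassersteinSq (f : Measure Vel) (g : Measure Vel) +
        ENNReal.ofReal ((1 - e ^ 2) / 4 * ‖mean f - mean g‖ ^ 2) := by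
  have hpos : 0 < (3 + e ^ 2) / 4 := by positivity
  rw [mul_wassersteinSq (ENNReal.ofReal_pos.2 hpos).ne' ENNReal.ofReal_ne_top]
  simp only [ENNReal.iInf_add]
  refine le_iInf₂ fun π hπ => ?_
  have hp := hπ.isProbabilityMeasure
  have hm := hasMarginals_collidePair e hπ
  have hL := memLp_sub_of_hasMarginals (inP2_gain hf) (inP2_gain hg) hm
  have hζ := memLp_sub_of_hasMarginals hf hg hπ
  refine (wassersteinSq_le hm).trans ?_
  have hcm := (continuous_collidePair e).measurable
  rw [cost_eq_integral hL, cost_eq_integral hζ, ← ENNReal.ofReal_mul hpos.le,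
    ← ENNReal.ofReal_add (mul_nonneg hpos.le (integral_nonneg fun _ => by positivity))
      (mul_nonneg (by linarith) (by positivity)),
    ← integral_sub_of_hasMarginals hf hg hπ, ← integral_integral_collision_form π e hζ]
  apply ENNReal.ofReal_le_ofReal
  have hi : Integrable (fun x => ‖(collidePair e x).1 - (collidePair e x).2‖ ^ 2)
      (π.prod (π.prod sphereProb)) :=
    (hL.integrable_norm_pow two_ne_zero).comp_measurable hcm
  have hq : Integrable (fun y : (Vel × Vel) × (Vel × Vel) =>
      ‖((3 - e) / 4) • (y.1.1 - y.1.2) + ((1 + e) / 4) • (y.2.1 - y.2.2)‖ ^ 2 +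
        ((1 + e) / 4 * ‖(y.1.1 - y.1.2) - (y.2.1 - y.2.2)‖) ^ 2) (π.prod π) :=
    integrable_collision_form e (hζ.comp_measurePreserving measurePreserving_fst)
      (hζ.comp_measurePreserving measurePreserving_snd)
  rw [integral_map hcm.aemeasurable (by fun_prop), integral_prod _ hi]
  refine integral_mono_ae hi.integral_prod_left hq.integral_prod_left ?_
  filter_upwards [hi.prod_right_ae, hq.prod_right_ae] with z hz hz'
  rw [integral_prod _ hz]
  refine integral_mono hz.integral_prod_left hz' fun z' => ?_
  exact integral_normSq_postVel_sub_le e z.1 z'.1 z.2 z'.2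

/-! ### Test functions -/

lemma abs_laplacian_le (φ : Vel → ℝ) (v : Vel) :
    |Laplacian.laplacian φ v| ≤ 3 * ‖iteratedFDeriv ℝ 2 φ v‖ := by
  rw [InnerProductSpace.laplacian_eq_iteratedFDeriv_orthonormalBasis φ
    (EuclideanSpace.basisFun (Fin 3) ℝ)]
  refine (Finset.abs_sum_le_sum_abs _ _).trans ?_
  have h : ∀ i ∈ (Finset.univ : Finset (Fin 3)),
      |iteratedFDeriv ℝ 2 φ v ![EuclideanSpace.basisFun (Fin 3) ℝ i,
        EuclideanSpace.basisFun (Fin 3) ℝ i]| ≤ ‖iteratedFDeriv ℝ 2 φ v‖ := by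
    intro i _
    rw [← Real.norm_eq_abs]
    refine ((iteratedFDeriv ℝ 2 φ v).le_opNorm _).trans ?_
    rw [Fin.prod_univ_two]
    simp
  refine (Finset.sum_le_sum h).trans ?_
  simp

/-- A smooth function of compact support which equals `1` on the unit ball. -/
def cutoffBump : ContDiffBump (0 : Vel) := ⟨1, 2, one_pos, one_lt_two⟩

/-- The smooth cutoff at scale `n + 1`. -/
def cutoff (n : ℕ) (v : Vel) : ℝ := cutoffBump (((n : ℝ) + 1)⁻¹ • v)

lemma contDiff_cutoff (n : ℕ) : ContDiff ℝ ∞ (cutoff n) :=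
  cutoffBump.contDiff.comp (contDiff_const_smul _)

lemma hasCompactSupport_cutoff (n : ℕ) : HasCompactSupport (cutoff n) :=
  cutoffBump.hasCompactSupport.comp_homeomorph
    (Homeomorph.smulOfNeZero (((n : ℝ) + 1)⁻¹) (by positivity))

lemma abs_cutoff_le_one (n : ℕ) (v : Vel) : |cutoff n v| ≤ 1 := by
  rw [cutoff, abs_of_nonneg cutoffBump.nonneg]
  exact cutoffBump.le_one

lemma eventually_cutoff_eq_one (v : Vel) :
    ∀ᶠ n : ℕ in atTop, cutoff n =ᶠ[𝓝 v] fun _ => 1 := by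
  obtain ⟨N, hN⟩ := exists_nat_gt ‖v‖
  filter_upwards [eventually_ge_atTop N] with n hn
  have hlt : ‖v‖ < n + 1 := by
    have : (N : ℝ) ≤ n := by exact_mod_cast hn
    linarith
  filter_upwards [continuous_norm.continuousAt.eventually_lt continuousAt_const hlt] with w hw
  refine cutoffBump.one_of_mem_closedBall ?_
  rw [mem_closedBall_zero_iff, norm_smul, norm_inv, Real.norm_of_nonneg (by positivity)]
  exact (inv_mul_le_one₀ (by positivity)).2 hw.le

lemma exists_norm_iteratedFDeriv_cutoff_le (i : ℕ) :
    ∃ C : ℝ, 0 ≤ C ∧ ∀ n v, ‖iteratedFDeriv ℝ i (cutoff n) v‖ ≤ C := by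
  have hs : ContDiff ℝ ∞ (cutoffBump : Vel → ℝ) := cutoffBump.contDiff
  obtain ⟨C, hC⟩ := (cutoffBump.hasCompactSupport.iteratedFDeriv (𝕜 := ℝ)
    i).exists_bound_of_continuous (hs.continuous_iteratedFDeriv (by exact_mod_cast le_top))
  refine ⟨C, (norm_nonneg _).trans (hC 0), fun n v => ?_⟩
  have h := congrFun (iteratedFDeriv_comp_const_smul (i := i) ((n : ℝ) + 1)⁻¹
    (hs.of_le (by exact_mod_cast le_top))) v
  have h' : iteratedFDeriv ℝ i (cutoff n) v = ((n : ℝ) + 1)⁻¹ ^ i •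
    iteratedFDeriv ℝ i (cutoffBump : Vel → ℝ) (((n : ℝ) + 1)⁻¹ • v) := h
  rw [h', norm_smul, norm_pow, norm_inv, Real.norm_of_nonneg (by positivity)]
  refine (mul_le_of_le_one_left (norm_nonneg _) (pow_le_one₀ (by positivity) ?_)).trans (hC _)
  exact inv_le_one_of_one_le₀ (by linarith [Nat.cast_nonneg (α := ℝ) n])

/-- Truncating a function with bounded derivatives keeps its Laplacian bounded, uniformly in the
scale of the truncation. -/
lemma exists_abs_laplacian_cutoff_mul_le {φ : Vel → ℝ} (hφ : ContDiff ℝ ∞ φ) {M : ℝ}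
    (hM : ∀ i ≤ 2, ∀ v, ‖iteratedFDeriv ℝ i φ v‖ ≤ M) :
    ∃ C : ℝ, ∀ n v, |Laplacian.laplacian (fun v => cutoff n v * φ v) v| ≤ C := by
  choose C hC0 hC using exists_norm_iteratedFDeriv_cutoff_le
  refine ⟨3 * ∑ i ∈ Finset.range 3, ((2 : ℕ).choose i) * C i * M, fun n v => ?_⟩
  refine (abs_laplacian_le _ v).trans ?_
  gcongr
  refine (norm_iteratedFDeriv_mul_le (contDiff_cutoff n) hφ v
    (WithTop.coe_le_coe.2 le_top)).trans ?_
  refine Finset.sum_le_sum fun i hi => ?_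
  have := hC0 i
  gcongr
  · exact hC i n v
  · exact hM _ (by omega) v

/-- The trigonometric test function `v ↦ cos (⟨v, k⟩ - a)`. -/
def wave (k : Vel) (a : ℝ) (v : Vel) : ℝ := Real.cos (⟪v, k⟫ - a)

lemma contDiff_wave (k : Vel) (a : ℝ) : ContDiff ℝ ∞ (wave k a) := by
  have h : ContDiff ℝ ∞ fun v : Vel => ⟪v, k⟫ := contDiff_id.inner ℝ contDiff_const
  unfold wave
  fun_prop

lemma continuous_wave (k : Vel) (a : ℝ) : Continuous (wave k a) :=
  (contDiff_wave k a).continuous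

lemma abs_wave_le_one (k : Vel) (a : ℝ) (v : Vel) : |wave k a v| ≤ 1 := Real.abs_cos_le_one _

lemma iteratedFDeriv_wave (k : Vel) (a : ℝ) (i : ℕ) (v : Vel) :
    iteratedFDeriv ℝ i (wave k a) v =
      (iteratedFDeriv ℝ i (fun x => Real.cos (x - a)) ⟪v, k⟫).compContinuousLinearMap
        fun _ => innerSL ℝ k := by
  have hc : ContDiff ℝ ∞ (fun x => Real.cos (x - a)) := by fun_prop
  have h := (innerSL ℝ k).iteratedFDeriv_comp_right hc v (i := i) (by exact_mod_cast le_top)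
  have h2 : (fun x => Real.cos (x - a)) ∘ ⇑(innerSL ℝ k) = wave k a := by
    funext w
    simp [wave, real_inner_comm]
  rw [h2] at h
  rw [h, innerSL_apply_apply, real_inner_comm]

lemma norm_iteratedFDeriv_wave_le (k : Vel) (a : ℝ) (i : ℕ) (v : Vel) :
    ‖iteratedFDeriv ℝ i (wave k a) v‖ ≤ ‖k‖ ^ i := by
  rw [iteratedFDeriv_wave]
  refine (ContinuousMultilinearMap.norm_compContinuousLinearMap_le _ _).trans ?_
  rw [Finset.prod_const, innerSL_apply_norm, Finset.card_univ, Fintype.card_fin,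
    norm_iteratedFDeriv_eq_norm_iteratedDeriv, iteratedDeriv_comp_sub_const]
  exact mul_le_of_le_one_left (by positivity) (Real.abs_iteratedDeriv_cos_le_one _ _)

lemma laplacian_wave (k : Vel) (a : ℝ) (v : Vel) :
    Laplacian.laplacian (wave k a) v = -‖k‖ ^ 2 * wave k a v := by
  have h2 : ∀ x, iteratedDeriv 2 Real.cos x = - Real.cos x := fun x => by
    simp
  rw [InnerProductSpace.laplacian_eq_iteratedFDeriv_orthonormalBasis _
    (EuclideanSpace.basisFun (Fin 3) ℝ)]
  simp only [iteratedFDeriv_wave, ContinuousMultilinearMap.compContinuousLinearMap_apply,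
    iteratedFDeriv_apply_eq_iteratedDeriv_mul_prod, iteratedDeriv_comp_sub_const, h2,
    Fin.prod_univ_two, smul_eq_mul, innerSL_apply_apply, Matrix.cons_val_zero, Matrix.cons_val_one]
  rw [← Finset.sum_mul, ← (EuclideanSpace.basisFun (Fin 3) ℝ).sum_sq_inner_left k]
  simp only [wave, pow_two]
  ring

/-! ### Weak continuity -/

lemma integrable_of_abs_le {φ : Vel → ℝ} (hφ : Continuous φ) {C : ℝ} (hC : ∀ v, |φ v| ≤ C)
    (μ : ProbabilityMeasure Vel) : Integrable φ (μ : Measure Vel) :=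
  Integrable.of_bound hφ.aestronglyMeasurable C (ae_of_all _ fun v => by simpa using hC v)

lemma abs_integral_le {φ : Vel → ℝ} {C : ℝ} (hC : ∀ v, |φ v| ≤ C) (μ : ProbabilityMeasure Vel) :
    |∫ v, φ v ∂(μ : Measure Vel)| ≤ C := by
  have := norm_integral_le_of_norm_le_const (μ := (μ : Measure Vel))
    (ae_of_all _ fun v => (by simpa using hC v : ‖φ v‖ ≤ C))
  simpa using this

lemma continuous_integral {φ : Vel → ℝ} (hφ : Continuous φ) {C : ℝ} (hC : ∀ v, |φ v| ≤ C) :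
    Continuous fun μ : ProbabilityMeasure Vel => ∫ v, φ v ∂(μ : Measure Vel) :=
  ProbabilityMeasure.continuous_integral_boundedContinuousFunction
    (BoundedContinuousFunction.ofNormedAddCommGroup φ hφ C hC)

lemma continuousOn_integral {f : ℝ → ProbabilityMeasure Vel} (hf : ContinuousOn f (Ici 0))
    {φ : Vel → ℝ} (hφ : Continuous φ) {C : ℝ} (hC : ∀ v, |φ v| ≤ C) :
    ContinuousOn (fun s => ∫ v, φ v ∂(f s : Measure Vel)) (Ici 0) :=
  (continuous_integral hφ hC).comp_continuousOn hf

lemma continuousOn_integral_gain (e : ℝ) {f : ℝ → ProbabilityMeasure Vel}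
    (hf : ContinuousOn f (Ici 0)) {φ : Vel → ℝ} (hφ : Continuous φ) {C : ℝ}
    (hC : ∀ v, |φ v| ≤ C) :
    ContinuousOn (fun s => ∫ v, φ v ∂(gain e (f s) : Measure Vel)) (Ici 0) :=
  ((continuous_integral hφ hC).comp (continuous_gain e)).comp_continuousOn hf

lemma aestronglyMeasurable_uIoc_of_continuousOn {F : ℝ → ℝ} (hF : ContinuousOn F (Ici 0)) {τ : ℝ}
    (hτ : 0 ≤ τ) : AEStronglyMeasurable F (volume.restrict (uIoc 0 τ)) := by
  rw [uIoc_of_le hτ]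
  exact (hF.mono fun s hs => hs.1.le).aestronglyMeasurable measurableSet_Ioc

lemma intervalIntegrable_of_continuousOn {F : ℝ → ℝ} (hF : ContinuousOn F (Ici 0)) {τ : ℝ}
    (hτ : 0 ≤ τ) : IntervalIntegrable F volume 0 τ :=
  (hF.mono fun s hs => by rw [uIcc_of_le hτ] at hs; exact hs.1).intervalIntegrable

/-- The weak formulation extends to smooth test functions which are bounded together with their
first two derivatives. -/
lemma IsSolution.weak_form_of_bounded {e A B p : ℝ} {f₀ : ProbabilityMeasure Vel}
    {f : ℝ → ProbabilityMeasure Vel} (hf : IsSolution e A B p f₀ f) {φ : Vel → ℝ}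
    (hφ : ContDiff ℝ ∞ φ) {M : ℝ} (hM : ∀ i ≤ 2, ∀ v, ‖iteratedFDeriv ℝ i φ v‖ ≤ M)
    {τ : ℝ} (hτ : 0 ≤ τ) :
    ∫ v, φ v ∂(f τ : Measure Vel) = ∫ v, φ v ∂(f₀ : Measure Vel) +
      ∫ s in (0 : ℝ)..τ, (collisionRate e * (∫ v, φ v ∂(gain e (f s) : Measure Vel) -
          ∫ v, φ v ∂(f s : Measure Vel)) +
        diffusivity e A B p (f s) * ∫ v, Laplacian.laplacian φ v ∂(f s : Measure Vel)) := by
  obtain ⟨C, hC⟩ := exists_abs_laplacian_cutoff_mul_le hφ hM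
  have hφM : ∀ v, |φ v| ≤ M := fun v => by simpa using hM 0 (by norm_num) v
  set ψ : ℕ → Vel → ℝ := fun n v => cutoff n v * φ v with hψ
  have hψs : ∀ n, ContDiff ℝ ∞ (ψ n) := fun n => (contDiff_cutoff n).mul hφ
  have hψM : ∀ n v, |ψ n v| ≤ M := fun n v => by
    rw [hψ, abs_mul]
    exact (mul_le_of_le_one_left (abs_nonneg _) (abs_cutoff_le_one n v)).trans (hφM v)
  have hψe : ∀ v, ∀ᶠ n in atTop, ψ n =ᶠ[𝓝 v] φ := fun v => by
    filter_upwards [eventually_cutoff_eq_one v] with n hn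
    filter_upwards [hn] with w hw
    simp [hψ, hw]
  have hlap : ∀ n, Continuous (Laplacian.laplacian (ψ n)) := fun n => by
    rw [InnerProductSpace.laplacian_eq_iteratedFDeriv_orthonormalBasis _
      (EuclideanSpace.basisFun (Fin 3) ℝ)]
    have : Continuous (iteratedFDeriv ℝ 2 (ψ n)) :=
      (hψs n).continuous_iteratedFDeriv (WithTop.coe_le_coe.2 le_top)
    fun_prop
  have hlim : ∀ μ : ProbabilityMeasure Vel,
      Tendsto (fun n => ∫ v, ψ n v ∂(μ : Measure Vel)) atTop (𝓝 (∫ v, φ v ∂(μ : Measure Vel))) := by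
    intro μ
    refine tendsto_integral_of_dominated_convergence (fun _ => M)
      (fun n => (hψs n).continuous.aestronglyMeasurable) (integrable_const _)
      (fun n => ae_of_all _ (hψM n)) (ae_of_all _ fun v => ?_)
    exact tendsto_const_nhds.congr' ((hψe v).mono fun n hn => hn.eq_of_nhds.symm)
  have hlimL : ∀ μ : ProbabilityMeasure Vel,
      Tendsto (fun n => ∫ v, Laplacian.laplacian (ψ n) v ∂(μ : Measure Vel)) atTop
        (𝓝 (∫ v, Laplacian.laplacian φ v ∂(μ : Measure Vel))) := by
    intro μ
    refine tendsto_integral_of_dominated_convergence (fun _ => C)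
      (fun n => (hlap n).aestronglyMeasurable) (integrable_const _)
      (fun n => ae_of_all _ (hC n)) (ae_of_all _ fun v => ?_)
    exact tendsto_const_nhds.congr' ((hψe v).mono fun n hn =>
      (InnerProductSpace.laplacian_congr_nhds hn).eq_of_nhds.symm)
  have hD := hf.diffusivity_integrable τ hτ
  have hDm : AEStronglyMeasurable (fun s => diffusivity e A B p (f s))
      (volume.restrict (uIoc 0 τ)) := hD.def'.aestronglyMeasurable
  have hweak : ∀ n, ∫ v, ψ n v ∂(f τ : Measure Vel) = ∫ v, ψ n v ∂(f₀ : Measure Vel) +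
      ∫ s in (0 : ℝ)..τ, (collisionRate e * (∫ v, ψ n v ∂(gain e (f s) : Measure Vel) -
          ∫ v, ψ n v ∂(f s : Measure Vel)) +
        diffusivity e A B p (f s) * ∫ v, Laplacian.laplacian (ψ n) v ∂(f s : Measure Vel)) := by
    intro n
    rw [hf.weak_form (ψ n) (hψs n) ((hasCompactSupport_cutoff n).mul_right) τ hτ]
    simp_rw [collision_eq e _ (hψs n).continuous (hψM n)]
  -- The collision term is dominated by `2 M E`, the diffusion term by `C Θ²`, which is integrable.
  refine tendsto_nhds_unique (hlim (f τ)) ?_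
  simp_rw [hweak]
  refine (hlim f₀).add (intervalIntegral.tendsto_integral_filter_of_dominated_convergence
    (fun s => |collisionRate e| * (M + M) + |diffusivity e A B p (f s)| * C) ?_ ?_ ?_ ?_)
  · refine Eventually.of_forall fun n => AEStronglyMeasurable.add ?_ (hDm.mul ?_)
    · exact aestronglyMeasurable_uIoc_of_continuousOn (continuousOn_const.mul
        ((continuousOn_integral_gain e hf.continuousOn (hψs n).continuous (hψM n)).sub
          (continuousOn_integral hf.continuousOn (hψs n).continuous (hψM n)))) hτ
    · exact aestronglyMeasurable_uIoc_of_continuousOn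
        (continuousOn_integral hf.continuousOn (hlap n) (hC n)) hτ
  · refine Eventually.of_forall fun n => ae_of_all _ fun s _ => ?_
    refine (norm_add_le _ _).trans (add_le_add ?_ ?_)
    · rw [norm_mul, Real.norm_eq_abs]
      gcongr
      exact (norm_sub_le _ _).trans (add_le_add (abs_integral_le (hψM n) _)
        (abs_integral_le (hψM n) _))
    · rw [norm_mul, Real.norm_eq_abs]
      gcongr
      exact abs_integral_le (hC n) _
  · exact intervalIntegrable_const.add (hD.abs.mul_const C)
  · refine ae_of_all _ fun s _ => ?_
    exact (((hlim _).sub (hlim _)).const_mul _).add ((hlimL _).const_mul _)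

/-! ### Integrating factors -/

/-- The exponential is Lipschitz on bounded sets, hence preserves absolute continuity. -/
lemma absolutelyContinuousOnInterval_exp {B : ℝ → ℝ} {a b : ℝ}
    (hB : AbsolutelyContinuousOnInterval B a b) :
    AbsolutelyContinuousOnInterval (fun t => Real.exp (B t)) a b := by
  obtain ⟨C, hC⟩ := isCompact_uIcc.exists_bound_of_continuousOn hB.continuousOn
  have hC' : ∀ t ∈ uIcc a b, B t ≤ C := fun t ht => (le_abs_self _).trans (hC t ht)
  have hlip : ∀ x ∈ uIcc a b, ∀ y ∈ uIcc a b,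
      dist (Real.exp (B x)) (Real.exp (B y)) ≤ Real.exp C * dist (B x) (B y) := by
    intro x hx y hy
    have h := Convex.norm_image_sub_le_of_norm_deriv_le (f := Real.exp) (s := Iic C)
      (C := Real.exp C) (x := B y) (y := B x) (fun _ _ => Real.differentiableAt_exp)
      (fun z hz => by simpa using hz) (convex_Iic C) (hC' y hy) (hC' x hx)
    simpa [dist_eq_norm] using h
  rw [absolutelyContinuousOnInterval_iff] at hB ⊢
  intro ε hε
  obtain ⟨δ, hδ, h⟩ := hB (ε / Real.exp C) (by positivity)
  refine ⟨δ, hδ, fun E hE hlt => ?_⟩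
  have h1 := h E hE hlt
  rw [lt_div_iff₀' (Real.exp_pos C), Finset.mul_sum] at h1
  refine (Finset.sum_le_sum fun i hi => ?_).trans_lt h1
  exact hlip _ (hE.1 i (hi)).1 _ (hE.1 i (hi)).2

/-- The integrating factor `exp (∫₀ᵗ b)` for a primitive `u` of an integrable function. -/
lemma exp_integral_mul_eq {u G b : ℝ → ℝ} {T : ℝ} (hT : 0 ≤ T)
    (hG : IntervalIntegrable G volume 0 T) (hb : IntervalIntegrable b volume 0 T)
    (hu : ∀ t ∈ Icc 0 T, u t = u 0 + ∫ s in (0 : ℝ)..t, G s) :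
    Real.exp (∫ s in (0 : ℝ)..T, b s) * u T =
      u 0 + ∫ s in (0 : ℝ)..T, Real.exp (∫ r in (0 : ℝ)..s, b r) * (G s + b s * u s) := by
  have hB := absolutelyContinuousOnInterval_exp
    (hb.absolutelyContinuousOnInterval_intervalIntegral (c := 0) left_mem_uIcc)
  have hU : AbsolutelyContinuousOnInterval (fun t => u 0 + ∫ s in (0 : ℝ)..t, G s) 0 T :=
    (LipschitzWith.const (u 0)).lipschitzOnWith.absolutelyContinuousOnInterval.fun_add
      (hG.absolutelyContinuousOnInterval_intervalIntegral (c := 0) left_mem_uIcc)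
  have h := AbsolutelyContinuousOnInterval.integral_deriv_mul_eq_sub hB hU
  rw [← hu T ⟨hT, le_rfl⟩] at h
  simp only [intervalIntegral.integral_same, Real.exp_zero, add_zero, one_mul] at h
  rw [← sub_eq_iff_eq_add', ← h]
  refine intervalIntegral.integral_congr_ae ?_
  filter_upwards [hG.ae_hasDerivAt_integral, hb.ae_hasDerivAt_integral] with s h1 h2 hs
  have hs' : s ∈ uIcc 0 T := uIoc_subset_uIcc hs
  have hd1 := ((h1 hs' 0 left_mem_uIcc).const_add (u 0)).deriv
  have hd2 := (h2 hs' 0 left_mem_uIcc).exp.deriv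
  rw [hd1, hd2, ← hu s (by rwa [uIcc_of_le hT] at hs')]
  ring

/-! ### The equation for trigonometric averages -/

/-- The average `∫ cos (⟨v, k⟩ - a) dμ(v)`; up to a phase, the characteristic function. -/
def waveAvg (k : Vel) (a : ℝ) (μ : ProbabilityMeasure Vel) : ℝ :=
  ∫ v, wave k a v ∂(μ : Measure Vel)

lemma abs_waveAvg_le_one (k : Vel) (a : ℝ) (μ : ProbabilityMeasure Vel) :
    |waveAvg k a μ| ≤ 1 :=
  abs_integral_le (abs_wave_le_one k a) μ

/-- The accumulated diffusion `∫₀ᵗ Θ²(f(s)) ds`. -/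
def diffusionTime (e A B p : ℝ) (f : ℝ → ProbabilityMeasure Vel) (t : ℝ) : ℝ :=
  ∫ s in (0 : ℝ)..t, diffusivity e A B p (f s)

namespace IsSolution

variable {e A B p : ℝ} {f₀ : ProbabilityMeasure Vel} {f : ℝ → ProbabilityMeasure Vel}

lemma continuousOn_waveAvg (hf : IsSolution e A B p f₀ f) (k : Vel) (a : ℝ) :
    ContinuousOn (fun s => waveAvg k a (f s)) (Ici 0) :=
  continuousOn_integral hf.continuousOn (continuous_wave k a) (abs_wave_le_one k a)

lemma continuousOn_waveAvg_gain (hf : IsSolution e A B p f₀ f) (k : Vel) (a : ℝ) :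
    ContinuousOn (fun s => waveAvg k a (gain e (f s))) (Ici 0) :=
  continuousOn_integral_gain e hf.continuousOn (continuous_wave k a) (abs_wave_le_one k a)

/-- For `cos (⟨v, k⟩ - a)`, an eigenfunction of the Laplacian, the diffusion term closes. -/
lemma waveAvg_eq (hf : IsSolution e A B p f₀ f) (k : Vel) (a : ℝ) {τ : ℝ} (hτ : 0 ≤ τ) :
    waveAvg k a (f τ) = waveAvg k a (f 0) +
      ∫ s in (0 : ℝ)..τ, (collisionRate e * (waveAvg k a (gain e (f s)) - waveAvg k a (f s)) -
        ‖k‖ ^ 2 * (diffusivity e A B p (f s) * waveAvg k a (f s))) := by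
  have hM : ∀ i ≤ 2, ∀ v, ‖iteratedFDeriv ℝ i (wave k a) v‖ ≤ 1 + ‖k‖ + ‖k‖ ^ 2 := by
    intro i hi v
    refine (norm_iteratedFDeriv_wave_le k a i v).trans ?_
    have := norm_nonneg k
    interval_cases i <;> nlinarith
  have h := hf.weak_form_of_bounded (contDiff_wave k a) hM hτ
  rw [hf.initial]
  simp only [laplacian_wave, integral_const_mul] at h
  rw [waveAvg, h]
  refine congrArg _ (intervalIntegral.integral_congr fun s _ => ?_)
  simp only [waveAvg]
  ring

lemma intervalIntegrable_diffusivity_mul (hf : IsSolution e A B p f₀ f) {F : ℝ → ℝ} {τ : ℝ}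
    (hτ : 0 ≤ τ) (hF : ContinuousOn F (Ici 0)) :
    IntervalIntegrable (fun s => diffusivity e A B p (f s) * F s) volume 0 τ :=
  (hf.diffusivity_integrable τ hτ).mul_continuousOn
    (hF.mono fun s hs => by rw [uIcc_of_le hτ] at hs; exact hs.1)

/-- Mild forms of the equation for trigonometric averages: with `c = ‖k‖²` the diffusion is
absorbed into the integrating factor, with `c = 0` only the loss term is. -/
lemma mild_waveAvg (hf : IsSolution e A B p f₀ f) (k : Vel) (a c : ℝ) {τ : ℝ} (hτ : 0 ≤ τ) :
    Real.exp (collisionRate e * τ + c * diffusionTime e A B p f τ) * waveAvg k a (f τ) =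
      waveAvg k a (f 0) + ∫ s in (0 : ℝ)..τ,
        Real.exp (collisionRate e * s + c * diffusionTime e A B p f s) *
          (collisionRate e * waveAvg k a (gain e (f s)) +
            (c - ‖k‖ ^ 2) * (diffusivity e A B p (f s) * waveAvg k a (f s))) := by
  have hD := hf.diffusivity_integrable τ hτ
  have hexp : ∀ s ∈ Icc 0 τ, ∫ r in (0 : ℝ)..s, (collisionRate e + c * diffusivity e A B p (f r)) =
      collisionRate e * s + c * diffusionTime e A B p f s := by
    intro s hs
    rw [intervalIntegral.integral_add intervalIntegrable_const
      ((hf.diffusivity_integrable s hs.1).const_mul c), intervalIntegral.integral_const_mul,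
      diffusionTime]
    simp [mul_comm]
  have hG : IntervalIntegrable (fun s =>
      collisionRate e * (waveAvg k a (gain e (f s)) - waveAvg k a (f s)) -
        ‖k‖ ^ 2 * (diffusivity e A B p (f s) * waveAvg k a (f s))) volume 0 τ :=
    (intervalIntegrable_of_continuousOn (continuousOn_const.mul
      ((hf.continuousOn_waveAvg_gain k a).sub (hf.continuousOn_waveAvg k a))) hτ).sub
      ((hf.intervalIntegrable_diffusivity_mul hτ (hf.continuousOn_waveAvg k a)).const_mul _)
  have h := exp_integral_mul_eq hτ hG
    (b := fun s => collisionRate e + c * diffusivity e A B p (f s))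
    (intervalIntegrable_const.add (hD.const_mul c))
    (fun t ht => hf.waveAvg_eq k a ht.1)
  rw [hexp τ ⟨hτ, le_rfl⟩] at h
  rw [h]
  refine congrArg _ (intervalIntegral.integral_congr fun s hs => ?_)
  rw [uIcc_of_le hτ] at hs
  simp only [hexp s hs]
  ring

end IsSolution

/-! ### Moments as limits of trigonometric averages -/

lemma sin_eq_mul_sinc (y : ℝ) : Real.sin y = y * Real.sinc y := by
  rcases eq_or_ne y 0 with rfl | h
  · simp
  · rw [Real.sinc_of_ne_zero h]
    field_simp

lemma tendsto_inv_smul (k : Vel) :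
    Tendsto (fun n : ℕ => ((n : ℝ) + 1)⁻¹ • k) atTop (𝓝 0) := by
  have h := (tendsto_one_div_add_atTop_nhds_zero_nat (𝕜 := ℝ)).smul_const k
  simpa using h

lemma tendsto_mul_sinc (c x : ℝ) :
    Tendsto (fun n : ℕ => Real.sinc (c * (((n : ℝ) + 1)⁻¹ * x))) atTop (𝓝 1) := by
  have h := (tendsto_one_div_add_atTop_nhds_zero_nat (𝕜 := ℝ)).mul_const x |>.const_mul c
  have h2 := (Real.continuous_sinc.tendsto _).comp h
  simpa using! h2

/-- The second moment `∫ ⟨v, k⟩² dμ(v)` in the direction `k`. -/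
def dirMoment (k : Vel) (μ : ProbabilityMeasure Vel) : ℝ :=
  ∫ v, ⟪v, k⟫ ^ 2 ∂(μ : Measure Vel)

/-- The bounded approximation `2 (1 - cos (ε x)) / ε²` of `x²`, with `ε = 1 / (n + 1)`, averaged
over `x = ⟨v, k⟩`. -/
def truncMoment (k : Vel) (n : ℕ) (μ : ProbabilityMeasure Vel) : ℝ :=
  2 * ((n : ℝ) + 1) ^ 2 * (1 - waveAvg (((n : ℝ) + 1)⁻¹ • k) 0 μ)

/-- The bounded approximation `sin (ε x) / ε` of `x`, with `ε = 1 / (n + 1)`, averaged over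
`x = ⟨v, k⟩`. -/
def truncMean (k : Vel) (n : ℕ) (μ : ProbabilityMeasure Vel) : ℝ :=
  ((n : ℝ) + 1) * waveAvg (((n : ℝ) + 1)⁻¹ • k) (Real.pi / 2) μ

lemma truncMoment_eq (k : Vel) (n : ℕ) (μ : ProbabilityMeasure Vel) :
    truncMoment k n μ =
      ∫ v, ⟪v, k⟫ ^ 2 * Real.sinc (1 / 2 * (((n : ℝ) + 1)⁻¹ * ⟪v, k⟫)) ^ 2 ∂(μ : Measure Vel) := by
  have hi := integrable_of_abs_le (continuous_wave (((n : ℝ) + 1)⁻¹ • k) 0)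
    (abs_wave_le_one _ _) μ
  have h1 : 1 - waveAvg (((n : ℝ) + 1)⁻¹ • k) 0 μ =
      ∫ v, (1 - wave (((n : ℝ) + 1)⁻¹ • k) 0 v) ∂(μ : Measure Vel) := by
    rw [integral_sub (integrable_const _) hi, waveAvg]
    simp
  rw [truncMoment, h1, ← integral_const_mul]
  refine integral_congr_ae (ae_of_all _ fun v => ?_)
  have hn : ((n : ℝ) + 1) ≠ 0 := by positivity
  simp only [wave, sub_zero, inner_smul_right]
  set y := 1 / 2 * (((n : ℝ) + 1)⁻¹ * ⟪v, k⟫) with hy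
  have h2 : ((n : ℝ) + 1)⁻¹ * ⟪v, k⟫ = 2 * y := by rw [hy]; ring
  have h3 : ⟪v, k⟫ = 2 * ((n : ℝ) + 1) * y := by rw [hy]; field_simp
  rw [h2, h3, Real.cos_two_mul, Real.cos_sq', sin_eq_mul_sinc y]
  ring

lemma truncMean_eq (k : Vel) (n : ℕ) (μ : ProbabilityMeasure Vel) :
    truncMean k n μ =
      ∫ v, ⟪v, k⟫ * Real.sinc (1 * (((n : ℝ) + 1)⁻¹ * ⟪v, k⟫)) ∂(μ : Measure Vel) := by
  rw [truncMean, waveAvg, ← integral_const_mul]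
  refine integral_congr_ae (ae_of_all _ fun v => ?_)
  have hn : ((n : ℝ) + 1) ≠ 0 := by positivity
  simp only [wave, inner_smul_right, Real.cos_sub_pi_div_two, one_mul]
  rw [sin_eq_mul_sinc]
  field_simp

lemma InP2.integrable_inner {μ : ProbabilityMeasure Vel} (hμ : InP2 μ) (k : Vel) :
    Integrable (fun v : Vel => ⟪v, k⟫) (μ : Measure Vel) :=
  hμ.integrable.inner_const k

lemma InP2.integrable_inner_sq {μ : ProbabilityMeasure Vel} (hμ : InP2 μ) (k : Vel) :
    Integrable (fun v : Vel => ⟪v, k⟫ ^ 2) (μ : Measure Vel) := by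
  refine (hμ.integrable_normSq.mul_const (‖k‖ ^ 2)).mono' (by fun_prop) (ae_of_all _ fun v => ?_)
  rw [Real.norm_of_nonneg (by positivity), ← mul_pow, ← sq_abs]
  exact pow_le_pow_left₀ (abs_nonneg _) (abs_real_inner_le_norm v k) 2

lemma truncMoment_nonneg (k : Vel) (n : ℕ) (μ : ProbabilityMeasure Vel) :
    0 ≤ truncMoment k n μ := by
  rw [truncMoment_eq]
  exact integral_nonneg fun v => by positivity

lemma sinc_sq_le_one (x : ℝ) : Real.sinc x ^ 2 ≤ 1 := by
  rw [← sq_abs]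
  exact pow_le_one₀ (abs_nonneg _) (Real.abs_sinc_le_one x)

lemma truncMoment_le (k : Vel) (n : ℕ) {μ : ProbabilityMeasure Vel} (hμ : InP2 μ) :
    truncMoment k n μ ≤ dirMoment k μ := by
  rw [truncMoment_eq]
  refine integral_mono_of_nonneg (ae_of_all _ fun v => by positivity) (hμ.integrable_inner_sq k)
    (ae_of_all _ fun v => ?_)
  exact mul_le_of_le_one_right (by positivity) (sinc_sq_le_one _)

lemma tendsto_truncMoment (k : Vel) {μ : ProbabilityMeasure Vel} (hμ : InP2 μ) :
    Tendsto (fun n => truncMoment k n μ) atTop (𝓝 (dirMoment k μ)) := by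
  have hs := Real.continuous_sinc
  simp_rw [truncMoment_eq]
  refine tendsto_integral_of_dominated_convergence (fun v => ⟪v, k⟫ ^ 2) (fun n => ?_)
    (hμ.integrable_inner_sq k) (fun n => ae_of_all _ fun v => ?_) (ae_of_all _ fun v => ?_)
  · have : Continuous fun v : Vel => ⟪v, k⟫ := by fun_prop
    exact Continuous.aestronglyMeasurable (by fun_prop)
  · rw [Real.norm_of_nonneg (by positivity)]
    exact mul_le_of_le_one_right (by positivity) (sinc_sq_le_one _)
  · simpa using ((tendsto_mul_sinc (1 / 2) ⟪v, k⟫).pow 2).const_mul (⟪v, k⟫ ^ 2)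

lemma tendsto_truncMean (k : Vel) {μ : ProbabilityMeasure Vel} (hμ : InP2 μ) :
    Tendsto (fun n => truncMean k n μ) atTop (𝓝 ⟪mean μ, k⟫) := by
  have hs := Real.continuous_sinc
  have hm : ⟪mean μ, k⟫ = ∫ v, ⟪v, k⟫ ∂(μ : Measure Vel) := by
    rw [real_inner_comm, mean, ← integral_inner hμ.integrable]
    simp_rw [real_inner_comm]
  simp_rw [truncMean_eq, hm]
  refine tendsto_integral_of_dominated_convergence (fun v => ‖⟪v, k⟫‖) (fun n => ?_)
    (hμ.integrable_inner k).norm (fun n => ae_of_all _ fun v => ?_) (ae_of_all _ fun v => ?_)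
  · have : Continuous fun v : Vel => ⟪v, k⟫ := by fun_prop
    exact Continuous.aestronglyMeasurable (by fun_prop)
  · rw [norm_mul]
    exact mul_le_of_le_one_right (by positivity) (Real.abs_sinc_le_one _)
  · simpa using (tendsto_mul_sinc 1 ⟪v, k⟫).const_mul ⟪v, k⟫

lemma abs_truncMean_le (k : Vel) (n : ℕ) {μ : ProbabilityMeasure Vel} (hμ : InP2 μ) :
    |truncMean k n μ| ≤ ‖k‖ * (1 + secondMoment μ) := by
  rw [truncMean_eq, secondMoment, ← Real.norm_eq_abs]
  have h : ∀ v : Vel, ‖⟪v, k⟫ * Real.sinc (1 * (((n : ℝ) + 1)⁻¹ * ⟪v, k⟫))‖ ≤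
      ‖k‖ * (1 + ‖v‖ ^ 2) := by
    intro v
    rw [norm_mul]
    refine (mul_le_of_le_one_right (norm_nonneg _) (Real.abs_sinc_le_one _)).trans ?_
    refine (norm_inner_le_norm v k).trans ?_
    rw [mul_comm]
    gcongr
    nlinarith [sq_nonneg (‖v‖ - 1), norm_nonneg v]
  refine (norm_integral_le_of_norm_le (((integrable_const 1).fun_add
    hμ.integrable_normSq).const_mul ‖k‖) (ae_of_all _ h)).trans_eq ?_
  rw [integral_const_mul, integral_add (integrable_const _) hμ.integrable_normSq]
  simp

lemma tendsto_waveAvg_one (k : Vel) (μ : ProbabilityMeasure Vel) :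
    Tendsto (fun n : ℕ => waveAvg (((n : ℝ) + 1)⁻¹ • k) 0 μ) atTop (𝓝 1) := by
  have hc : ∀ v : Vel, Continuous fun k : Vel => wave k 0 v := fun v => by
    have : Continuous fun k : Vel => ⟪v, k⟫ := by fun_prop
    unfold wave
    fun_prop
  have h : Tendsto (fun n : ℕ => waveAvg (((n : ℝ) + 1)⁻¹ • k) 0 μ) atTop
      (𝓝 (∫ v, wave 0 0 v ∂(μ : Measure Vel))) :=
    tendsto_integral_of_dominated_convergence (fun _ => 1)
      (fun n => (continuous_wave _ _).aestronglyMeasurable) (integrable_const _)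
      (fun n => ae_of_all _ fun v => abs_wave_le_one _ _ v)
      (ae_of_all _ fun v => ((hc v).tendsto 0).comp (tendsto_inv_smul k))
  exact (by simp [wave] : ∫ v, wave 0 0 v ∂(μ : Measure Vel) = 1) ▸ h

lemma secondMoment_eq_sum {μ : ProbabilityMeasure Vel} (hμ : InP2 μ) :
    secondMoment μ = ∑ i, dirMoment (EuclideanSpace.basisFun (Fin 3) ℝ i) μ := by
  simp only [dirMoment, secondMoment]
  rw [← integral_finsetSum _ fun i _ => hμ.integrable_inner_sq _]
  simp_rw [OrthonormalBasis.sum_sq_inner_left]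

/-! ### Energy and momentum balance -/

lemma integral_exp_mul (c τ : ℝ) :
    ∫ s in (0 : ℝ)..τ, Real.exp (c * s) * c = Real.exp (c * τ) - 1 := by
  have h : ∀ s ∈ uIcc 0 τ, HasDerivAt (fun s => Real.exp (c * s)) (Real.exp (c * s) * c) s :=
    fun s _ => by simpa using ((hasDerivAt_id s).const_mul c).exp
  rw [intervalIntegral.integral_eq_sub_of_hasDerivAt h
    (Continuous.intervalIntegrable (by fun_prop) _ _)]
  simp

lemma diffusivity_nonneg {e A B : ℝ} (he : e ^ 2 < 1) (hA : 0 < A) (hB : 0 < B) (p : ℝ)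
    (μ : ProbabilityMeasure Vel) : 0 ≤ diffusivity e A B p μ := by
  have h : 0 < 1 - e ^ 2 := by linarith
  have := temperature_nonneg μ
  unfold diffusivity collisionRate
  positivity

lemma eight_le_collisionRate {e : ℝ} (he : e ^ 2 < 1) : 8 ≤ collisionRate e := by
  have h : 0 < 1 - e ^ 2 := by linarith
  rw [collisionRate, le_div_iff₀ h]
  nlinarith [sq_nonneg e]

lemma norm_inv_smul_sq (k : Vel) (n : ℕ) :
    ‖((n : ℝ) + 1)⁻¹ • k‖ ^ 2 = (((n : ℝ) + 1)⁻¹) ^ 2 * ‖k‖ ^ 2 := by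
  rw [norm_smul, norm_inv, Real.norm_of_nonneg (by positivity), mul_pow]

namespace IsSolution

variable {e A B p : ℝ} {f₀ : ProbabilityMeasure Vel} {f : ℝ → ProbabilityMeasure Vel}

lemma continuousOn_truncMoment_gain (hf : IsSolution e A B p f₀ f) (k : Vel) (n : ℕ) :
    ContinuousOn (fun s => truncMoment k n (gain e (f s))) (Ici 0) :=
  continuousOn_const.mul (continuousOn_const.sub (hf.continuousOn_waveAvg_gain _ _))

lemma intervalIntegrable_exp_mul_diffusivity (hf : IsSolution e A B p f₀ f) (c : ℝ)
    {τ : ℝ} (hτ : 0 ≤ τ) {F : ℝ → ℝ} (hF : ContinuousOn F (Ici 0)) :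
    IntervalIntegrable (fun s => Real.exp (collisionRate e * s) *
      (c * (diffusivity e A B p (f s) * F s))) volume 0 τ :=
  ((hf.intervalIntegrable_diffusivity_mul hτ hF).const_mul c).continuousOn_mul (by fun_prop)

/-- The truncated second moment satisfies the mild form of the moment equation exactly; only the
factor `waveAvg` in the diffusion term differs from its limit `1`. -/
lemma truncMoment_balance (hf : IsSolution e A B p f₀ f) (k : Vel) (n : ℕ) {τ : ℝ} (hτ : 0 ≤ τ) :
    Real.exp (collisionRate e * τ) * truncMoment k n (f τ) = truncMoment k n (f 0) +
      ((∫ s in (0 : ℝ)..τ, Real.exp (collisionRate e * s) *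
          (collisionRate e * truncMoment k n (gain e (f s)))) +
        ∫ s in (0 : ℝ)..τ, Real.exp (collisionRate e * s) * (2 * ‖k‖ ^ 2 *
          (diffusivity e A B p (f s) * waveAvg (((n : ℝ) + 1)⁻¹ • k) 0 (f s)))) := by
  set κ := ((n : ℝ) + 1)⁻¹ • k with hκ
  set N := (n : ℝ) + 1 with hN
  have hN0 : N ≠ 0 := by positivity
  have hexp : IntervalIntegrable (fun s => Real.exp (collisionRate e * s) * collisionRate e)
    volume 0 τ := Continuous.intervalIntegrable (by fun_prop) _ _
  have hX : IntervalIntegrable (fun s => Real.exp (collisionRate e * s) *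
      (collisionRate e * waveAvg κ 0 (gain e (f s)))) volume 0 τ :=
    intervalIntegrable_of_continuousOn (ContinuousOn.mul (by fun_prop)
      (continuousOn_const.mul (hf.continuousOn_waveAvg_gain κ 0))) hτ
  have hY := fun c => hf.intervalIntegrable_exp_mul_diffusivity c hτ (hf.continuousOn_waveAvg κ 0)
  have h := hf.mild_waveAvg κ 0 0 hτ
  simp only [zero_mul, add_zero, zero_sub, mul_add] at h
  rw [intervalIntegral.integral_add hX (hY _)] at h
  have h1 : ∫ s in (0 : ℝ)..τ, Real.exp (collisionRate e * s) *
      (collisionRate e * truncMoment k n (gain e (f s))) =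
      2 * N ^ 2 * ((Real.exp (collisionRate e * τ) - 1) - ∫ s in (0 : ℝ)..τ,
        Real.exp (collisionRate e * s) * (collisionRate e * waveAvg κ 0 (gain e (f s)))) := by
    rw [← integral_exp_mul, ← intervalIntegral.integral_sub hexp hX,
      ← intervalIntegral.integral_const_mul]
    refine intervalIntegral.integral_congr fun s _ => ?_
    simp only [truncMoment, ← hκ, ← hN]
    ring
  have h2 : ∫ s in (0 : ℝ)..τ, Real.exp (collisionRate e * s) * (2 * ‖k‖ ^ 2 *
      (diffusivity e A B p (f s) * waveAvg κ 0 (f s))) =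
      -(2 * N ^ 2) * ∫ s in (0 : ℝ)..τ, Real.exp (collisionRate e * s) * (-‖κ‖ ^ 2 *
      (diffusivity e A B p (f s) * waveAvg κ 0 (f s))) := by
    rw [← intervalIntegral.integral_const_mul]
    refine intervalIntegral.integral_congr fun s _ => ?_
    have hκn : ‖κ‖ ^ 2 = N⁻¹ ^ 2 * ‖k‖ ^ 2 := norm_inv_smul_sq k n
    simp only [hκn]
    field_simp
  rw [h1, h2]
  simp only [truncMoment, ← hκ, ← hN]
  linear_combination -(2 * N ^ 2) * h

/-- The gain term has a time-integrable directional second moment. No bound on the second moment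
that is locally uniform in time is part of the definition of a solution; it comes from Fatou's
lemma, because the mild form writes a finite quantity as a sum of nonnegative terms. -/
lemma intervalIntegrable_dirMoment_gain (hf : IsSolution e A B p f₀ f) (he : e ^ 2 < 1)
    (hA : 0 < A) (hB : 0 < B) (k : Vel) {τ : ℝ} (hτ : 0 ≤ τ) :
    IntervalIntegrable (fun s => dirMoment k (gain e (f s))) volume 0 τ := by
  have hE := eight_le_collisionRate he
  have hh := diffusivity_nonneg he hA hB p
  have hcont := hf.continuousOn_truncMoment_gain k
  have hint := fun n => intervalIntegrable_of_continuousOn (hcont n) hτ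
  have hexp1 : ∀ s ∈ Icc 0 τ, 1 ≤ Real.exp (collisionRate e * s) := fun s hs =>
    Real.one_le_exp (mul_nonneg (by linarith) hs.1)
  set K := Real.exp (collisionRate e * τ) * dirMoment k (f τ) +
    ∫ s in (0 : ℝ)..τ, Real.exp (collisionRate e * s) * (2 * ‖k‖ ^ 2 *
      (diffusivity e A B p (f s) * 1)) with hK
  have hbound : ∀ n, ∫ s in (0 : ℝ)..τ, truncMoment k n (gain e (f s)) ≤ K := by
    intro n
    have h1 : ∫ s in (0 : ℝ)..τ, truncMoment k n (gain e (f s)) ≤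
        ∫ s in (0 : ℝ)..τ, Real.exp (collisionRate e * s) *
          (collisionRate e * truncMoment k n (gain e (f s))) := by
      refine intervalIntegral.integral_mono_on hτ (hint n)
        (intervalIntegrable_of_continuousOn (ContinuousOn.mul (by fun_prop)
          (continuousOn_const.mul (hcont n))) hτ) fun s hs => ?_
      have h0 := truncMoment_nonneg k n (gain e (f s))
      have h2 := hexp1 s hs
      rw [← mul_assoc]
      exact le_mul_of_one_le_left h0 (one_le_mul_of_one_le_of_one_le h2 (by linarith))
    have h2 : -∫ s in (0 : ℝ)..τ, Real.exp (collisionRate e * s) * (2 * ‖k‖ ^ 2 *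
          (diffusivity e A B p (f s) * waveAvg (((n : ℝ) + 1)⁻¹ • k) 0 (f s))) ≤
        ∫ s in (0 : ℝ)..τ, Real.exp (collisionRate e * s) * (2 * ‖k‖ ^ 2 *
          (diffusivity e A B p (f s) * 1)) := by
      rw [← intervalIntegral.integral_neg]
      refine intervalIntegral.integral_mono_on hτ (hf.intervalIntegrable_exp_mul_diffusivity _ hτ
        (hf.continuousOn_waveAvg _ 0)).neg (hf.intervalIntegrable_exp_mul_diffusivity _ hτ
        continuousOn_const) fun s hs => ?_
      have h3 := (abs_le.1 (abs_waveAvg_le_one (((n : ℝ) + 1)⁻¹ • k) 0 (f s))).1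
      have h4 := hh (f s)
      rw [← mul_neg, ← mul_neg, ← mul_neg]
      gcongr
      linarith
    have h3 := hf.truncMoment_balance k n hτ
    have h4 := truncMoment_nonneg k n (f 0)
    have h5 := mul_le_mul_of_nonneg_left (truncMoment_le k n (hf.inP2 τ hτ))
      (Real.exp_nonneg (collisionRate e * τ))
    rw [hK]
    linarith
  rw [intervalIntegrable_iff_integrableOn_Ioc_of_le hτ]
  refine integrable_of_tendsto (G := fun n s => truncMoment k n (gain e (f s))) ?_
    (fun n => (hint n).1.aestronglyMeasurable) (ne_top_of_le_ne_top
      (ENNReal.ofReal_ne_top (r := K)) (liminf_le_of_le (by isBoundedDefault) ?_))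
  · refine (ae_restrict_iff' measurableSet_Ioc).2 (ae_of_all _ fun s hs => ?_)
    exact tendsto_truncMoment k (inP2_gain (hf.inP2 s hs.1.le))
  · intro b hb
    obtain ⟨n, hn⟩ := hb.exists
    refine hn.trans ?_
    rw [← ofReal_integral_norm_eq_lintegral_enorm (hint n).1]
    refine ENNReal.ofReal_le_ofReal (le_trans (le_of_eq ?_) (hbound n))
    rw [intervalIntegral.integral_of_le hτ]
    exact integral_congr_ae (ae_of_all _ fun s => Real.norm_of_nonneg (truncMoment_nonneg k n _))

/-- The mild form of the equation for the directional second moments, by dominated convergence in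
the truncated form. The factors `1` keep the shape of the approximating integrals. -/
lemma dirMoment_balance (hf : IsSolution e A B p f₀ f) (he : e ^ 2 < 1)
    (hA : 0 < A) (hB : 0 < B) (k : Vel) {τ : ℝ} (hτ : 0 ≤ τ) :
    Real.exp (collisionRate e * τ) * dirMoment k (f τ) = dirMoment k (f 0) +
      ((∫ s in (0 : ℝ)..τ, Real.exp (collisionRate e * s) *
          (collisionRate e * dirMoment k (gain e (f s)))) +
        ∫ s in (0 : ℝ)..τ, Real.exp (collisionRate e * s) * (2 * ‖k‖ ^ 2 *
          (diffusivity e A B p (f s) * 1))) := by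
  have hE := eight_le_collisionRate he
  refine tendsto_nhds_unique ((tendsto_truncMoment k (hf.inP2 τ hτ)).const_mul _) ?_
  simp_rw [hf.truncMoment_balance k _ hτ]
  refine (tendsto_truncMoment k (hf.inP2 0 le_rfl)).add (Tendsto.add ?_ ?_)
  · refine intervalIntegral.tendsto_integral_filter_of_dominated_convergence
      (fun s => Real.exp (collisionRate e * s) *
          (collisionRate e * dirMoment k (gain e (f s)))) ?_ ?_ ?_ ?_
    · exact Eventually.of_forall fun n => aestronglyMeasurable_uIoc_of_continuousOn
        (ContinuousOn.mul (by fun_prop)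
          (continuousOn_const.mul (hf.continuousOn_truncMoment_gain k n))) hτ
    · refine Eventually.of_forall fun n => ae_of_all _ fun s hs => ?_
      rw [uIoc_of_le hτ] at hs
      have h0 := truncMoment_nonneg k n (gain e (f s))
      rw [Real.norm_of_nonneg (by positivity)]
      gcongr
      exact truncMoment_le k n (inP2_gain (hf.inP2 s hs.1.le))
    · exact ((hf.intervalIntegrable_dirMoment_gain he hA hB k hτ).const_mul _).continuousOn_mul
        (by fun_prop)
    · refine ae_of_all _ fun s hs => ?_
      rw [uIoc_of_le hτ] at hs
      exact ((tendsto_truncMoment k (inP2_gain (hf.inP2 s hs.1.le))).const_mul _).const_mul _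
  · refine intervalIntegral.tendsto_integral_filter_of_dominated_convergence
      (fun s => Real.exp (collisionRate e * s) * (2 * ‖k‖ ^ 2 *
          (diffusivity e A B p (f s) * 1))) ?_ ?_ ?_ ?_
    · exact Eventually.of_forall fun n => (hf.intervalIntegrable_exp_mul_diffusivity _ hτ
        (hf.continuousOn_waveAvg _ 0)).def'.aestronglyMeasurable
    · refine Eventually.of_forall fun n => ae_of_all _ fun s hs => ?_
      have h4 := diffusivity_nonneg he hA hB p (f s)
      rw [norm_mul, norm_mul, norm_mul (diffusivity e A B p (f s)),
        Real.norm_of_nonneg (Real.exp_nonneg _), Real.norm_of_nonneg h4,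
        Real.norm_of_nonneg (by positivity : 0 ≤ 2 * ‖k‖ ^ 2)]
      gcongr
      exact abs_waveAvg_le_one _ _ _
    · exact hf.intervalIntegrable_exp_mul_diffusivity _ hτ continuousOn_const
    · exact ae_of_all _ fun s hs =>
        (((tendsto_waveAvg_one k (f s)).const_mul _).const_mul _).const_mul _

lemma intervalIntegrable_secondMoment_gain (hf : IsSolution e A B p f₀ f) (he : e ^ 2 < 1)
    (hA : 0 < A) (hB : 0 < B) {τ : ℝ} (hτ : 0 ≤ τ) :
    IntervalIntegrable (fun s => secondMoment (gain e (f s))) volume 0 τ := by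
  have h := IntervalIntegrable.sum Finset.univ fun i _ =>
    hf.intervalIntegrable_dirMoment_gain he hA hB (EuclideanSpace.basisFun (Fin 3) ℝ i) hτ
  refine h.congr fun s hs => ?_
  rw [uIoc_of_le hτ] at hs
  rw [secondMoment_eq_sum (inP2_gain (hf.inP2 s hs.1.le))]
  simp

/-- The mean velocity is conserved. -/
lemma mean_eq (hf : IsSolution e A B p f₀ f) (he : e ^ 2 < 1)
    (hA : 0 < A) (hB : 0 < B) {τ : ℝ} (hτ : 0 ≤ τ) : mean (f τ) = mean f₀ := by
  refine ext_inner_right ℝ fun k => ?_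
  have hE := eight_le_collisionRate he
  have hb : ∀ n, truncMean k n (f τ) = truncMean k n (f 0) +
      ∫ s in (0 : ℝ)..τ, (collisionRate e * (truncMean k n (gain e (f s)) - truncMean k n (f s)) -
        (((n : ℝ) + 1)⁻¹) ^ 2 * ‖k‖ ^ 2 * (diffusivity e A B p (f s) * truncMean k n (f s))) := by
    intro n
    simp only [truncMean]
    rw [hf.waveAvg_eq _ _ hτ, mul_add, ← intervalIntegral.integral_const_mul]
    refine congrArg _ (intervalIntegral.integral_congr fun s _ => ?_)
    simp only [norm_inv_smul_sq]
    ring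
  have hlim0 : Tendsto (fun n : ℕ => (((n : ℝ) + 1)⁻¹) ^ 2 * ‖k‖ ^ 2) atTop (𝓝 0) := by
    have := ((tendsto_one_div_add_atTop_nhds_zero_nat (𝕜 := ℝ)).pow 2).mul_const (‖k‖ ^ 2)
    simpa using this
  have key : ⟪mean (f τ), k⟫ = ⟪mean (f 0), k⟫ + ∫ s in (0 : ℝ)..τ, (0 : ℝ) := by
    refine tendsto_nhds_unique (tendsto_truncMean k (hf.inP2 τ hτ)) ?_
    simp_rw [hb]
    refine (tendsto_truncMean k (hf.inP2 0 le_rfl)).add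
      (intervalIntegral.tendsto_integral_filter_of_dominated_convergence
      (fun s => collisionRate e * (‖k‖ * (2 + 3 * secondMoment (gain e (f s)))) +
        ‖k‖ ^ 2 * diffusivity e A B p (f s)) ?_ ?_ ?_ ?_)
    · refine Eventually.of_forall fun n => ?_
      have h1 : ContinuousOn (fun s => truncMean k n (f s)) (Ici 0) :=
        continuousOn_const.mul (hf.continuousOn_waveAvg _ _)
      have h2 : ContinuousOn (fun s => truncMean k n (gain e (f s))) (Ici 0) :=
        continuousOn_const.mul (hf.continuousOn_waveAvg_gain _ _)
      exact (aestronglyMeasurable_uIoc_of_continuousOn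
        (continuousOn_const.mul (h2.sub h1)) hτ).sub
        ((hf.intervalIntegrable_diffusivity_mul hτ h1).const_mul _).def'.aestronglyMeasurable
    · refine Eventually.of_forall fun n => ae_of_all _ fun s hs => ?_
      rw [uIoc_of_le hτ] at hs
      have hP := hf.inP2 s hs.1.le
      have h4 := diffusivity_nonneg he hA hB p (f s)
      have h1 := abs_truncMean_le k n hP
      have h2 := abs_truncMean_le k n (inP2_gain (e := e) hP)
      -- Time-integrability is only known for the moment of the gain term, which dominates this one.
      have h3 : secondMoment (f s) ≤ 2 * secondMoment (gain e (f s)) := by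
        rw [secondMoment_gain e hP]
        have := secondMoment_nonneg (f s)
        have h6 : 0 ≤ (1 - e ^ 2) / 4 * ‖mean (f s)‖ ^ 2 :=
          mul_nonneg (by linarith) (by positivity)
        nlinarith [mul_nonneg (sq_nonneg e) this]
      refine (norm_sub_le _ _).trans (add_le_add ?_ ?_)
      · rw [norm_mul, Real.norm_of_nonneg (by linarith : 0 ≤ collisionRate e)]
        gcongr
        refine (norm_sub_le _ _).trans ((add_le_add h2 h1).trans ?_)
        rw [← mul_add]
        exact mul_le_mul_of_nonneg_left (by linarith) (norm_nonneg k)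
      -- A product of `Θ²` with a moment need not be integrable a priori, so the crude bound by
      -- `n + 1` is used here, and the factor `1 / (n + 1)²` compensates for it.
      · have h6 : ‖truncMean k n (f s)‖ ≤ (n : ℝ) + 1 := by
          rw [truncMean, norm_mul, Real.norm_of_nonneg (by positivity)]
          exact mul_le_of_le_one_right (by positivity) (abs_waveAvg_le_one _ _ _)
        have h7 : (((n : ℝ) + 1)⁻¹) ^ 2 * ((n : ℝ) + 1) ≤ 1 := by
          rw [pow_two, mul_assoc, inv_mul_cancel₀ (by positivity), mul_one]
          exact inv_le_one_of_one_le₀ (by linarith [Nat.cast_nonneg (α := ℝ) n])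
        rw [norm_mul, norm_mul (diffusivity e A B p (f s)), Real.norm_of_nonneg h4,
          Real.norm_of_nonneg (by positivity)]
        calc _ ≤ (((n : ℝ) + 1)⁻¹) ^ 2 * ‖k‖ ^ 2 *
              (diffusivity e A B p (f s) * ((n : ℝ) + 1)) := by gcongr
          _ = ((((n : ℝ) + 1)⁻¹) ^ 2 * ((n : ℝ) + 1)) *
              (‖k‖ ^ 2 * diffusivity e A B p (f s)) := by ring
          _ ≤ _ := mul_le_of_le_one_left (by positivity) h7
    · exact (((intervalIntegrable_const.add ((hf.intervalIntegrable_secondMoment_gain he hA hB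
        hτ).const_mul 3)).const_mul _).const_mul _).add
          ((hf.diffusivity_integrable τ hτ).const_mul _)
    · refine ae_of_all _ fun s hs => ?_
      rw [uIoc_of_le hτ] at hs
      have hP := hf.inP2 s hs.1.le
      have h1 := tendsto_truncMean k hP
      have h2 := tendsto_truncMean k (inP2_gain (e := e) hP)
      rw [mean_gain e hP] at h2
      simpa using ((h2.sub h1).const_mul (collisionRate e)).sub (hlim0.mul (h1.const_mul
        (diffusivity e A B p (f s))))
  simpa [hf.initial] using key

end IsSolution

/-! ### The temperature equation -/

/-- A primitive which grows at most linearly wherever it is positive stays nonpositive. -/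
lemma nonpos_of_integral_le_mul {y g : ℝ → ℝ} {K T : ℝ} (hT : 0 ≤ T)
    (hg : IntervalIntegrable g volume 0 T) (hy : ∀ t ∈ Icc 0 T, y t = ∫ s in (0 : ℝ)..t, g s)
    (hle : ∀ᵐ s ∂(volume.restrict (Ioi (0 : ℝ))), s ∈ Icc 0 T → 0 < y s → g s ≤ K * y s) :
    y T ≤ 0 := by
  have hsub : ∀ t ∈ Icc 0 T, uIcc 0 t ⊆ uIcc 0 T := fun t ht => by
    rw [uIcc_of_le ht.1, uIcc_of_le hT]
    exact Icc_subset_Icc_right ht.2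
  have hy0 : y 0 = 0 := by simpa using hy 0 ⟨le_rfl, hT⟩
  have hycont : ContinuousOn y (Icc 0 T) := by
    have h := intervalIntegral.continuousOn_primitive_interval
      (by rwa [uIcc_of_le hT, ← intervalIntegrable_iff_integrableOn_Icc_of_le hT] :
        IntegrableOn g (uIcc 0 T))
    rw [uIcc_of_le hT] at h
    exact h.congr hy
  set G : ℝ → ℝ := fun s => Real.exp (-K * s) * (g s + -K * y s) with hG
  have hGi : IntervalIntegrable G volume 0 T :=
    (hg.add ((hycont.mono (by rw [uIcc_of_le hT])).intervalIntegrable.const_mul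
      (-K))).continuousOn_mul (by fun_prop)
  have hz : ∀ t ∈ Icc 0 T, Real.exp (-K * t) * y t = ∫ s in (0 : ℝ)..t, G s := by
    intro t ht
    have h := exp_integral_mul_eq (u := y) (b := fun _ => -K) ht.1 (hg.mono_set (hsub t ht))
      intervalIntegrable_const
      (fun s hs => by rw [hy0, zero_add]; exact hy s ⟨hs.1, hs.2.trans ht.2⟩)
    simpa [hG, hy0, mul_comm] using h
  by_contra hpos
  push Not at hpos
  -- After the last time `σ` at which `y ≤ 0`, the function `exp (-K s) y s` cannot increase.
  set S := {s ∈ Icc 0 T | y s ≤ 0} with hS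
  have hSc : IsCompact S := by
    have : IsClosed S := hycont.preimage_isClosed_of_isClosed isClosed_Icc isClosed_Iic
    exact isCompact_Icc.of_isClosed_subset this fun s hs => hs.1
  have hσ : sSup S ∈ S := hSc.sSup_mem ⟨0, ⟨le_rfl, hT⟩, hy0.le⟩
  set σ := sSup S
  have hσT : σ ≤ T := hσ.1.2
  have hgt : ∀ s ∈ Ioc σ T, 0 < y s := by
    intro s hs
    by_contra hns
    push Not at hns
    exact absurd (le_csSup hSc.bddAbove ⟨⟨hσ.1.1.trans hs.1.le, hs.2⟩, hns⟩) (not_le.2 hs.1)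
  have h1 := hz T ⟨hT, le_rfl⟩
  have h2 := hz σ hσ.1
  have h3 : (∫ s in (0 : ℝ)..T, G s) - ∫ s in (0 : ℝ)..σ, G s = ∫ s in σ..T, G s :=
    intervalIntegral.integral_interval_sub_left hGi (hGi.mono_set (hsub σ hσ.1))
  have h4 : ∫ s in σ..T, G s ≤ 0 := by
    rw [intervalIntegral.integral_of_le hσT]
    refine integral_nonpos_of_ae ?_
    rw [EventuallyLE, ae_restrict_iff' measurableSet_Ioc]
    rw [ae_restrict_iff' measurableSet_Ioi] at hle
    filter_upwards [hle] with s hs hsm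
    have hs0 : 0 < s := hσ.1.1.trans_lt hsm.1
    have := hs hs0 ⟨hs0.le, hsm.2⟩ (hgt s hsm)
    exact mul_nonpos_of_nonneg_of_nonpos (Real.exp_nonneg _) (by linarith)
  have h5 : Real.exp (-K * σ) * y σ ≤ 0 :=
    mul_nonpos_of_nonneg_of_nonpos (Real.exp_nonneg _) hσ.2
  have h6 : 0 < Real.exp (-K * T) * y T := by positivity
  linarith

/-- For `q ≤ 1` the power `x ^ q` grows at most linearly on `[δ, ∞)`. -/
lemma rpow_sub_rpow_le {δ x y q : ℝ} (hδ : 0 < δ) (hδy : δ ≤ y) (hyx : y ≤ x) (hq : q ≤ 1) :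
    x ^ q - y ^ q ≤ δ ^ (q - 1) * (x - y) := by
  have hy : 0 < y := hδ.trans_le hδy
  have h1 : (x / y) ^ q ≤ x / y := by
    conv_rhs => rw [← Real.rpow_one (x / y)]
    exact Real.rpow_le_rpow_of_exponent_le ((one_le_div hy).2 hyx) hq
  have h2 : x ^ q = y ^ q * (x / y) ^ q := by
    rw [← Real.mul_rpow hy.le (div_nonneg (hy.le.trans hyx) hy.le), mul_div_cancel₀ _ hy.ne']
  have h3 : y ^ q = y ^ (q - 1) * y := by
    rw [Real.rpow_sub_one hy.ne']
    field_simp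
  calc x ^ q - y ^ q = y ^ q * ((x / y) ^ q - 1) := by rw [h2]; ring
    _ ≤ y ^ q * (x / y - 1) := by gcongr
    _ = y ^ (q - 1) * (x - y) := by rw [h3]; field_simp
    _ ≤ _ := by
      refine mul_le_mul_of_nonneg_right ?_ (by linarith)
      exact Real.rpow_le_rpow_of_nonpos hδ hδy (by linarith)

lemma collisionRate_mul {e : ℝ} (he : e ^ 2 < 1) : collisionRate e * ((1 - e ^ 2) / 4) = 2 := by
  have h : 1 - e ^ 2 ≠ 0 := by linarith
  rw [collisionRate]
  field_simp
  norm_num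

namespace IsSolution

variable {e A B p : ℝ} {f₀ : ProbabilityMeasure Vel} {f : ℝ → ProbabilityMeasure Vel}

lemma secondMoment_balance (hf : IsSolution e A B p f₀ f) (he : e ^ 2 < 1)
    (hA : 0 < A) (hB : 0 < B) {τ : ℝ} (hτ : 0 ≤ τ) :
    Real.exp (collisionRate e * τ) * secondMoment (f τ) = secondMoment (f 0) +
      ((∫ s in (0 : ℝ)..τ, Real.exp (collisionRate e * s) *
          (collisionRate e * secondMoment (gain e (f s)))) +
        ∫ s in (0 : ℝ)..τ, Real.exp (collisionRate e * s) * (6 *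
          (diffusivity e A B p (f s) * 1))) := by
  have hsum : ∫ s in (0 : ℝ)..τ, Real.exp (collisionRate e * s) *
      (collisionRate e * secondMoment (gain e (f s))) =
      ∑ i, ∫ s in (0 : ℝ)..τ, Real.exp (collisionRate e * s) *
      (collisionRate e * dirMoment (EuclideanSpace.basisFun (Fin 3) ℝ i) (gain e (f s))) := by
    rw [← intervalIntegral.integral_finsetSum fun i _ =>
      ((hf.intervalIntegrable_dirMoment_gain he hA hB _ hτ).const_mul _).continuousOn_mul
        (by fun_prop)]
    refine intervalIntegral.integral_congr fun s hs => ?_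
    rw [uIcc_of_le hτ] at hs
    simp only [secondMoment_eq_sum (inP2_gain (hf.inP2 s hs.1)), Finset.mul_sum]
  rw [secondMoment_eq_sum (hf.inP2 τ hτ), secondMoment_eq_sum (hf.inP2 0 le_rfl), hsum,
    Finset.mul_sum]
  simp_rw [hf.dirMoment_balance he hA hB _ hτ]
  simp only [Finset.sum_add_distrib]
  congr 2
  simp only [OrthonormalBasis.norm_eq_one, Finset.sum_const, Finset.card_univ, Fintype.card_fin,
    nsmul_eq_mul]
  rw [← intervalIntegral.integral_const_mul]
  refine intervalIntegral.integral_congr fun s _ => ?_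
  push_cast
  ring

lemma collisionRate_mul_secondMoment_gain (hf : IsSolution e A B p f₀ f) (he : e ^ 2 < 1)
    (hA : 0 < A) (hB : 0 < B) {s : ℝ} (hs : 0 ≤ s) :
    collisionRate e * secondMoment (gain e (f s)) =
      3 * (collisionRate e - 2) * temperature (f s) + collisionRate e * ‖mean f₀‖ ^ 2 := by
  rw [secondMoment_gain e (hf.inP2 s hs), temperature_eq (hf.inP2 s hs), hf.mean_eq he hA hB hs]
  linear_combination (‖mean f₀‖ ^ 2 - secondMoment (f s)) * collisionRate_mul he

lemma intervalIntegrable_temperature (hf : IsSolution e A B p f₀ f) (he : e ^ 2 < 1)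
    (hA : 0 < A) (hB : 0 < B) {τ : ℝ} (hτ : 0 ≤ τ) :
    IntervalIntegrable (fun s => temperature (f s)) volume 0 τ := by
  have hE := eight_le_collisionRate he
  have h := (((hf.intervalIntegrable_secondMoment_gain he hA hB hτ).const_mul
    (collisionRate e)).sub
    (intervalIntegrable_const (c := collisionRate e * ‖mean f₀‖ ^ 2))).mul_const (3 * (collisionRate e - 2))⁻¹
  refine h.congr fun s hs => ?_
  rw [uIoc_of_le hτ] at hs
  have h2 : 3 * (collisionRate e - 2) ≠ 0 := by
    have : 0 < collisionRate e - 2 := by linarith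
    positivity
  simp only [hf.collisionRate_mul_secondMoment_gain he hA hB hs.1.le]
  rw [add_sub_cancel_right, mul_comm (3 * (collisionRate e - 2)), mul_assoc, mul_inv_cancel₀ h2,
    mul_one]

/-- The mild form of the temperature equation `θ' = -2 θ + 2 Θ²`. -/
lemma temperature_balance (hf : IsSolution e A B p f₀ f) (he : e ^ 2 < 1)
    (hA : 0 < A) (hB : 0 < B) {τ : ℝ} (hτ : 0 ≤ τ) :
    Real.exp (collisionRate e * τ) * temperature (f τ) = temperature f₀ +
      ∫ s in (0 : ℝ)..τ, Real.exp (collisionRate e * s) *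
        ((collisionRate e - 2) * temperature (f s) + 2 * diffusivity e A B p (f s)) := by
  have hθ := hf.intervalIntegrable_temperature he hA hB hτ
  have hD := hf.diffusivity_integrable τ hτ
  have h1 : ∫ s in (0 : ℝ)..τ, Real.exp (collisionRate e * s) *
      (collisionRate e * secondMoment (gain e (f s))) =
      3 * (∫ s in (0 : ℝ)..τ, Real.exp (collisionRate e * s) *
        ((collisionRate e - 2) * temperature (f s))) +
      ‖mean f₀‖ ^ 2 * (Real.exp (collisionRate e * τ) - 1) := by
    rw [← integral_exp_mul, ← intervalIntegral.integral_const_mul,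
      ← intervalIntegral.integral_const_mul, ← intervalIntegral.integral_add]
    · refine intervalIntegral.integral_congr fun s hs => ?_
      rw [uIcc_of_le hτ] at hs
      simp only [hf.collisionRate_mul_secondMoment_gain he hA hB hs.1]
      ring
    · exact ((hθ.const_mul _).continuousOn_mul (by fun_prop)).const_mul _
    · exact Continuous.intervalIntegrable (by fun_prop) _ _
  have h2 : ∫ s in (0 : ℝ)..τ, Real.exp (collisionRate e * s) * (6 *
      (diffusivity e A B p (f s) * 1)) =
      3 * ∫ s in (0 : ℝ)..τ, Real.exp (collisionRate e * s) *
        (2 * diffusivity e A B p (f s)) := by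
    rw [← intervalIntegral.integral_const_mul]
    refine intervalIntegral.integral_congr fun s _ => ?_
    ring
  have h3 := hf.secondMoment_balance he hA hB hτ
  have hP0 : InP2 f₀ := hf.initial ▸ hf.inP2 0 le_rfl
  rw [h1, h2, hf.initial] at h3
  simp only [mul_add]
  rw [intervalIntegral.integral_add ((hθ.const_mul _).continuousOn_mul (by fun_prop))
    ((hD.const_mul _).continuousOn_mul (by fun_prop)), temperature_eq (hf.inP2 τ hτ),
    temperature_eq hP0, hf.mean_eq he hA hB hτ]
  linear_combination (1 / 3) * h3

/-- The temperature decays at most exponentially, so it stays away from zero on bounded intervals if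
it is positive initially. -/
lemma temperature_lower_bound (hf : IsSolution e A B p f₀ f) (he : e ^ 2 < 1)
    (hA : 0 < A) (hB : 0 < B) {s T : ℝ} (hs : 0 ≤ s) (hsT : s ≤ T) :
    Real.exp (-(collisionRate e * T)) * temperature f₀ ≤ temperature (f s) := by
  have hE := eight_le_collisionRate he
  have h := hf.temperature_balance he hA hB hs
  have h1 : 0 ≤ ∫ r in (0 : ℝ)..s, Real.exp (collisionRate e * r) *
      ((collisionRate e - 2) * temperature (f r) + 2 * diffusivity e A B p (f r)) := by
    refine intervalIntegral.integral_nonneg hs fun r _ => ?_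
    have h2 := diffusivity_nonneg he hA hB p (f r)
    have h3 := mul_nonneg (by linarith : 0 ≤ collisionRate e - 2) (temperature_nonneg (f r))
    positivity
  rw [Real.exp_neg, inv_mul_le_iff₀ (Real.exp_pos _)]
  calc temperature f₀ ≤ Real.exp (collisionRate e * s) * temperature (f s) := by linarith
    _ ≤ _ := by
      have := temperature_nonneg (f s)
      gcongr

variable {g₀ : ProbabilityMeasure Vel} {g : ℝ → ProbabilityMeasure Vel}

/-- Comparison for the temperature equation. For `p ≤ 1 / 2` the diffusivity is a nonincreasing
function of the temperature; for `1 / 2 < p < 3 / 2` its growth is at most linear away from zero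
temperature. By symmetry, the temperatures are equal. -/
lemma temperature_le (hf : IsSolution e A B p f₀ f) (hg : IsSolution e A B p g₀ g)
    (he : e ^ 2 < 1) (hA : 0 < A) (hB : 0 < B) (hp : p < 3 / 2)
    (h0 : temperature f₀ = temperature g₀) (hpos : 1 / 2 < p → 0 < temperature g₀)
    {τ : ℝ} (hτ : 0 ≤ τ) : temperature (f τ) ≤ temperature (g τ) := by
  have hE := eight_le_collisionRate he
  set δ := Real.exp (-(collisionRate e * τ)) * temperature g₀ with hδ
  set κ := collisionRate e * A / B with hκ
  have hκ0 : 0 < κ := by positivity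
  have hδ0 : 0 ≤ δ := mul_nonneg (Real.exp_nonneg _) (temperature_nonneg _)
  have hdiff : ∀ᵐ s ∂(volume.restrict (Ioi (0 : ℝ))), s ∈ Icc 0 τ →
      temperature (g s) < temperature (f s) →
      diffusivity e A B p (f s) - diffusivity e A B p (g s) ≤
        κ * δ ^ (p - 1 / 2 - 1) * (temperature (f s) - temperature (g s)) := by
    have hrhs : ∀ s, temperature (g s) < temperature (f s) →
        0 ≤ κ * δ ^ (p - 1 / 2 - 1) * (temperature (f s) - temperature (g s)) := fun s hs =>
      mul_nonneg (mul_nonneg hκ0.le (Real.rpow_nonneg hδ0 _)) (by linarith)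
    rcases lt_trichotomy p (1 / 2) with hp' | hp' | hp'
    -- Zero temperatures have to be excluded, where the negative power takes the value `0`.
    · filter_upwards [hg.diffusivity_defined hp'] with s hs _ hlt
      refine le_trans ?_ (hrhs s hlt)
      rw [sub_nonpos, diffusivity, diffusivity]
      exact mul_le_mul_of_nonneg_left
        (Real.rpow_le_rpow_of_nonpos hs hlt.le (by linarith)) hκ0.le
    · refine ae_of_all _ fun s _ hlt => le_trans (le_of_eq ?_) (hrhs s hlt)
      simp [diffusivity, hp']
    · refine ae_of_all _ fun s hs hlt => ?_
      have h1 : δ ≤ temperature (g s) := hg.temperature_lower_bound he hA hB hs.1 hs.2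
      have h2 := rpow_sub_rpow_le (q := p - 1 / 2)
        (mul_pos (Real.exp_pos _) (hpos hp') : 0 < δ) h1 hlt.le (by linarith)
      rw [diffusivity, diffusivity, ← mul_sub, mul_assoc κ]
      exact mul_le_mul_of_nonneg_left h2 hκ0.le
  have hint : ∀ {φ₀ : ProbabilityMeasure Vel} {φ : ℝ → ProbabilityMeasure Vel},
      IsSolution e A B p φ₀ φ → ∀ t, 0 ≤ t → IntervalIntegrable (fun s =>
        Real.exp (collisionRate e * s) *
          ((collisionRate e - 2) * temperature (φ s) + 2 * diffusivity e A B p (φ s)))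
        volume 0 t := fun hφ t ht =>
    (((hφ.intervalIntegrable_temperature he hA hB ht).const_mul _).add
      ((hφ.diffusivity_integrable t ht).const_mul _)).continuousOn_mul (by fun_prop)
  have key := nonpos_of_integral_le_mul
    (y := fun t => Real.exp (collisionRate e * t) * (temperature (f t) - temperature (g t)))
    (K := collisionRate e - 2 + 2 * (κ * δ ^ (p - 1 / 2 - 1))) hτ
    ((hint hf τ hτ).sub (hint hg τ hτ)) (fun t ht => by
      rw [mul_sub, hf.temperature_balance he hA hB ht.1, hg.temperature_balance he hA hB ht.1, h0,
        add_sub_add_left_eq_sub, ← intervalIntegral.integral_sub (hint hf t ht.1)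
        (hint hg t ht.1)]) (by
      filter_upwards [hdiff] with s hs hsτ hpos
      have hlt : temperature (g s) < temperature (f s) := by
        have := (mul_pos_iff_of_pos_left (Real.exp_pos _)).1 hpos
        linarith
      have h := mul_le_mul_of_nonneg_left (hs hsτ hlt) (Real.exp_nonneg (collisionRate e * s))
      nlinarith)
  have := nonpos_of_mul_nonpos_right key (Real.exp_pos _)
  linarith

end IsSolution

/-! ### Weighted Riemann sums -/

/-- The nodes `j τ / (N + 1)` of the uniform partition of `[0, τ]`. -/
def node (τ : ℝ) (N j : ℕ) : ℝ := j * (τ / ((N : ℝ) + 1))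

lemma node_zero (τ : ℝ) (N : ℕ) : node τ N 0 = 0 := by simp [node]

lemma node_last (τ : ℝ) (N : ℕ) : node τ N (N + 1) = τ := by
  have : (N : ℝ) + 1 ≠ 0 := by positivity
  rw [node]
  push_cast
  field_simp

lemma node_mono {τ : ℝ} (hτ : 0 ≤ τ) (N : ℕ) : Monotone (node τ N) := fun i j hij => by
  have : (i : ℝ) ≤ j := by exact_mod_cast hij
  unfold node
  gcongr

lemma node_mem {τ : ℝ} (hτ : 0 ≤ τ) {N j : ℕ} (hj : j ≤ N + 1) : node τ N j ∈ Icc 0 τ :=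
  ⟨node_zero τ N ▸ node_mono hτ N (Nat.zero_le j), (node_mono hτ N hj).trans_eq (node_last τ N)⟩

/-- Left-endpoint Riemann sums of a continuous function converge, with exact integration of the
weight. -/
lemma tendsto_weighted_riemann_sum {V : Type*} [NormedAddCommGroup V] [NormedSpace ℝ V]
    [CompleteSpace V] {w : ℝ → ℝ} (hw : Continuous w) (hw0 : ∀ s, 0 ≤ w s) {F : ℝ → V} {τ : ℝ}
    (hτ : 0 ≤ τ)
    (hF : ContinuousOn F (Icc 0 τ)) :
    Tendsto (fun N : ℕ => ∑ j ∈ Finset.range (N + 1),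
      (∫ s in node τ N j..node τ N (j + 1), w s) • F (node τ N j)) atTop
      (𝓝 (∫ s in (0 : ℝ)..τ, w s • F s)) := by
  rw [Metric.tendsto_atTop]
  intro ε hε
  have hC : 0 ≤ ∫ s in (0 : ℝ)..τ, w s := intervalIntegral.integral_nonneg hτ fun s _ => hw0 s
  set C := ∫ s in (0 : ℝ)..τ, w s with hCdef
  obtain ⟨δ, hδ, hUC⟩ := Metric.uniformContinuousOn_iff.1
    (isCompact_Icc.uniformContinuousOn_of_continuous hF) (ε / (C + 1)) (by positivity)
  obtain ⟨N₀, hN₀⟩ := exists_nat_gt (τ / δ)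
  refine ⟨N₀, fun N hN => ?_⟩
  have hmesh : τ / ((N : ℝ) + 1) < δ := by
    have h1 : (N₀ : ℝ) ≤ N := by exact_mod_cast hN
    rw [div_lt_iff₀ (by positivity)]
    rw [div_lt_iff₀ hδ] at hN₀
    nlinarith
  have hmem : ∀ j ∈ Finset.range (N + 1), ∀ s ∈ Icc (node τ N j) (node τ N (j + 1)),
      s ∈ Icc 0 τ := fun j hj s hs =>
    ⟨(node_mem hτ (Finset.mem_range.1 hj).le).1.trans hs.1,
      hs.2.trans (node_mem hτ (Finset.mem_range.1 hj)).2⟩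
  have hle : ∀ j, node τ N j ≤ node τ N (j + 1) := fun j => node_mono hτ N (Nat.le_succ j)
  have hwi : ∀ j, IntervalIntegrable w volume (node τ N j) (node τ N (j + 1)) :=
    fun j => hw.intervalIntegrable _ _
  have hwF : ∀ j ∈ Finset.range (N + 1), IntervalIntegrable (fun s => w s • F s) volume
      (node τ N j) (node τ N (j + 1)) := fun j hj =>
    ContinuousOn.intervalIntegrable (hw.continuousOn.smul (hF.mono fun s hs => hmem j hj s
      (by rwa [uIcc_of_le (hle j)] at hs)))
  have hsum : ∫ s in (0 : ℝ)..τ, w s • F s =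
      ∑ j ∈ Finset.range (N + 1), ∫ s in node τ N j..node τ N (j + 1), w s • F s := by
    rw [intervalIntegral.sum_integral_adjacent_intervals fun j hj =>
      hwF j (Finset.mem_range.2 hj), node_zero, node_last]
  have hsumw : C = ∑ j ∈ Finset.range (N + 1), ∫ s in node τ N j..node τ N (j + 1), w s := by
    rw [intervalIntegral.sum_integral_adjacent_intervals fun j _ => hwi j, node_zero, node_last]
  have hterm : ∀ j ∈ Finset.range (N + 1),
      ‖(∫ s in node τ N j..node τ N (j + 1), w s) • F (node τ N j) -
        ∫ s in node τ N j..node τ N (j + 1), w s • F s‖ ≤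
      ε / (C + 1) * ∫ s in node τ N j..node τ N (j + 1), w s := by
    intro j hj
    have hwc : IntervalIntegrable (fun s => w s • F (node τ N j)) volume
        (node τ N j) (node τ N (j + 1)) := Continuous.intervalIntegrable (by fun_prop) _ _
    rw [← intervalIntegral.integral_smul_const, ← intervalIntegral.integral_sub hwc (hwF j hj),
      ← intervalIntegral.integral_const_mul]
    refine intervalIntegral.norm_integral_le_of_norm_le (hle j) (ae_of_all _ fun s hs => ?_)
      ((hwi j).const_mul _)
    rw [← smul_sub, norm_smul, Real.norm_of_nonneg (hw0 s), mul_comm]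
    refine mul_le_mul_of_nonneg_right ?_ (hw0 s)
    rw [← dist_eq_norm]
    refine (hUC _ (hmem j hj _ ⟨le_rfl, hle j⟩) _ (hmem j hj s ⟨hs.1.le, hs.2⟩) ?_).le
    have h1 : node τ N (j + 1) - node τ N j = τ / ((N : ℝ) + 1) := by
      simp only [node]
      push_cast
      ring
    rw [dist_comm, Real.dist_eq, abs_of_nonneg (by linarith [hs.1])]
    linarith [hs.2]
  rw [dist_eq_norm, hsum, ← Finset.sum_sub_distrib]
  refine (norm_sum_le_of_le _ hterm).trans_lt ?_
  rw [← Finset.mul_sum, ← hsumw, div_mul_eq_mul_div, div_lt_iff₀ (by positivity)]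
  nlinarith

/-! ### Heat flow and Duhamel's formula -/

/-- The centred Gaussian measure with characteristic function `exp (-r ‖k‖²)`, the fundamental
solution of the heat equation at time `r ≥ 0`. -/
def heat (r : ℝ) : Measure Vel :=
  (ProbabilityTheory.stdGaussian Vel).map (fun v => Real.sqrt (2 * r) • v)

instance isProbabilityMeasure_heat (r : ℝ) : IsProbabilityMeasure (heat r) :=
  Measure.isProbabilityMeasure_map (by fun_prop)

lemma charFun_heat {r : ℝ} (hr : 0 ≤ r) (k : Vel) :
    charFun (heat r) k = (Real.exp (-(‖k‖ ^ 2 * r)) : ℂ) := by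
  rw [heat, charFun_map_smul, ProbabilityTheory.charFun_stdGaussian, norm_smul,
    Real.norm_of_nonneg (Real.sqrt_nonneg _)]
  push_cast
  rw [mul_pow, ← Complex.ofReal_pow, Real.sq_sqrt (by positivity)]
  push_cast
  ring_nf

/-- The phases `a = 0` and `a = π / 2` give the real and the imaginary part. -/
lemma charFun_eq_waveAvg (μ : ProbabilityMeasure Vel) (k : Vel) :
    charFun (μ : Measure Vel) k =
      (waveAvg k 0 μ : ℂ) + (waveAvg k (Real.pi / 2) μ : ℂ) * Complex.I := by
  have h0 := integrable_of_abs_le (continuous_wave k 0) (abs_wave_le_one k 0) μ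
  have h1 := integrable_of_abs_le (continuous_wave k (Real.pi / 2)) (abs_wave_le_one k _) μ
  rw [charFun_apply, waveAvg, waveAvg, ← integral_complex_ofReal, ← integral_complex_ofReal,
    ← integral_mul_const, ← integral_add h0.ofReal (h1.ofReal.mul_const _)]
  refine integral_congr_ae (ae_of_all _ fun v => ?_)
  simp only [wave, sub_zero, Real.cos_sub_pi_div_two, Complex.exp_mul_I, Complex.ofReal_cos,
    Complex.ofReal_sin]

/-- The weight `E exp (-E (τ - s))` of the gain term at time `s` in Duhamel's formula for time `τ`;
probabilistically, the density of the last collision time before `τ`. -/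
def lossWeight (e τ s : ℝ) : ℝ :=
  collisionRate e * Real.exp (-(collisionRate e * (τ - s)))

lemma continuous_lossWeight (e τ : ℝ) : Continuous (lossWeight e τ) := by
  unfold lossWeight
  fun_prop

lemma lossWeight_nonneg {e : ℝ} (he : e ^ 2 < 1) (τ s : ℝ) : 0 ≤ lossWeight e τ s :=
  mul_nonneg (by linarith [eight_le_collisionRate he]) (Real.exp_nonneg _)

lemma integral_lossWeight (e τ : ℝ) :
    ∫ s in (0 : ℝ)..τ, lossWeight e τ s = 1 - Real.exp (-(collisionRate e * τ)) := by
  have h : ∀ s, lossWeight e τ s = Real.exp (-(collisionRate e * τ)) *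
      (Real.exp (collisionRate e * s) * collisionRate e) := fun s => by
    rw [lossWeight, ← mul_assoc, ← Real.exp_add, mul_comm]
    ring_nf
  simp_rw [h]
  rw [intervalIntegral.integral_const_mul, integral_exp_mul, mul_sub, ← Real.exp_add]
  simp

namespace IsSolution

variable {e A B p : ℝ} {f₀ : ProbabilityMeasure Vel} {f : ℝ → ProbabilityMeasure Vel}

lemma continuousOn_diffusionTime (hf : IsSolution e A B p f₀ f) {τ : ℝ} (hτ : 0 ≤ τ) :
    ContinuousOn (diffusionTime e A B p f) (Icc 0 τ) := by
  have h := intervalIntegral.continuousOn_primitive_interval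
    (by rw [uIcc_of_le hτ, ← intervalIntegrable_iff_integrableOn_Icc_of_le hτ]
        exact hf.diffusivity_integrable τ hτ :
      IntegrableOn (fun s => diffusivity e A B p (f s)) (uIcc 0 τ))
  rwa [uIcc_of_le hτ] at h

lemma diffusionTime_mono (hf : IsSolution e A B p f₀ f) (he : e ^ 2 < 1) (hA : 0 < A)
    (hB : 0 < B) {s τ : ℝ} (hs : 0 ≤ s) (hsτ : s ≤ τ) :
    diffusionTime e A B p f s ≤ diffusionTime e A B p f τ := by
  have h := intervalIntegral.integral_interval_sub_left
    (hf.diffusivity_integrable τ (hs.trans hsτ)) (hf.diffusivity_integrable s hs)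
  have h2 : 0 ≤ ∫ r in s..τ, diffusivity e A B p (f r) :=
    intervalIntegral.integral_nonneg hsτ fun r _ => diffusivity_nonneg he hA hB p (f r)
  unfold diffusionTime
  linarith

lemma duhamel_waveAvg (hf : IsSolution e A B p f₀ f) (k : Vel) (a : ℝ) {τ : ℝ} (hτ : 0 ≤ τ) :
    waveAvg k a (f τ) = Real.exp (-(collisionRate e * τ)) *
        (Real.exp (-(‖k‖ ^ 2 * diffusionTime e A B p f τ)) * waveAvg k a f₀) +
      ∫ s in (0 : ℝ)..τ, lossWeight e τ s *
        (Real.exp (-(‖k‖ ^ 2 * (diffusionTime e A B p f τ - diffusionTime e A B p f s))) *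
          waveAvg k a (gain e (f s))) := by
  have h := hf.mild_waveAvg k a (‖k‖ ^ 2) hτ
  simp only [sub_self, zero_mul, add_zero] at h
  set X := collisionRate e * τ + ‖k‖ ^ 2 * diffusionTime e A B p f τ with hX
  have h2 : waveAvg k a (f τ) = Real.exp (-X) * (Real.exp X * waveAvg k a (f τ)) := by
    rw [← mul_assoc, ← Real.exp_add, neg_add_cancel, Real.exp_zero, one_mul]
  rw [h2, h, mul_add, hf.initial, ← intervalIntegral.integral_const_mul]
  congr 1
  · rw [← mul_assoc, ← Real.exp_add, hX, neg_add]
  · refine intervalIntegral.integral_congr fun s _ => ?_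
    have h3 : Real.exp (-X) * Real.exp (collisionRate e * s + ‖k‖ ^ 2 * diffusionTime e A B p f s) =
        Real.exp (-(collisionRate e * (τ - s))) *
          Real.exp (-(‖k‖ ^ 2 * (diffusionTime e A B p f τ - diffusionTime e A B p f s))) := by
      rw [← Real.exp_add, ← Real.exp_add, hX]
      ring_nf
    rw [← mul_assoc, h3, lossWeight]
    ring

lemma continuousOn_duhamel_integrand (hf : IsSolution e A B p f₀ f) (k : Vel) (a : ℝ) {τ : ℝ}
    (hτ : 0 ≤ τ) :
    ContinuousOn (fun s =>
      Real.exp (-(‖k‖ ^ 2 * (diffusionTime e A B p f τ - diffusionTime e A B p f s))) *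
        waveAvg k a (gain e (f s))) (Icc 0 τ) :=
  (Real.continuous_exp.comp_continuousOn (continuousOn_const.mul
    (continuousOn_const.sub (hf.continuousOn_diffusionTime hτ))).neg).mul
    ((hf.continuousOn_waveAvg_gain k a).mono fun _ hs => hs.1)

lemma continuousOn_duhamel_charFun (hf : IsSolution e A B p f₀ f) (k : Vel) {τ : ℝ}
    (hτ : 0 ≤ τ) :
    ContinuousOn (fun s =>
      (Real.exp (-(‖k‖ ^ 2 * (diffusionTime e A B p f τ - diffusionTime e A B p f s))) : ℂ) *
        charFun (gain e (f s) : Measure Vel) k) (Icc 0 τ) := by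
  have h := fun a => Complex.continuous_ofReal.comp_continuousOn
    (hf.continuousOn_duhamel_integrand k a hτ)
  refine ((h 0).add ((h (Real.pi / 2)).mul_const Complex.I)).congr fun s _ => ?_
  simp only [charFun_eq_waveAvg, Pi.add_apply, Function.comp_apply, Complex.ofReal_mul]
  ring

/-- Duhamel's formula on the Fourier side. -/
lemma duhamel_charFun (hf : IsSolution e A B p f₀ f) (k : Vel) {τ : ℝ} (hτ : 0 ≤ τ) :
    charFun (f τ : Measure Vel) k = Real.exp (-(collisionRate e * τ)) •
        ((Real.exp (-(‖k‖ ^ 2 * diffusionTime e A B p f τ)) : ℂ) * charFun (f₀ : Measure Vel) k) +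
      ∫ s in (0 : ℝ)..τ, lossWeight e τ s •
        ((Real.exp (-(‖k‖ ^ 2 * (diffusionTime e A B p f τ - diffusionTime e A B p f s))) : ℂ) *
          charFun (gain e (f s) : Measure Vel) k) := by
  have hI : ∀ a, IntervalIntegrable (fun s => ((lossWeight e τ s *
      (Real.exp (-(‖k‖ ^ 2 * (diffusionTime e A B p f τ - diffusionTime e A B p f s))) *
        waveAvg k a (gain e (f s))) : ℝ) : ℂ)) volume 0 τ := fun a =>
    ContinuousOn.intervalIntegrable (Complex.continuous_ofReal.comp_continuousOn
      ((continuous_lossWeight e τ).continuousOn.mul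
        (by rw [uIcc_of_le hτ]; exact hf.continuousOn_duhamel_integrand k a hτ)))
  have hsplit : ∀ s, lossWeight e τ s •
      ((Real.exp (-(‖k‖ ^ 2 * (diffusionTime e A B p f τ - diffusionTime e A B p f s))) : ℂ) *
        charFun (gain e (f s) : Measure Vel) k) =
      ((lossWeight e τ s *
        (Real.exp (-(‖k‖ ^ 2 * (diffusionTime e A B p f τ - diffusionTime e A B p f s))) *
          waveAvg k 0 (gain e (f s))) : ℝ) : ℂ) +
      ((lossWeight e τ s *
        (Real.exp (-(‖k‖ ^ 2 * (diffusionTime e A B p f τ - diffusionTime e A B p f s))) *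
          waveAvg k (Real.pi / 2) (gain e (f s))) : ℝ) : ℂ) * Complex.I := fun s => by
    simp only [charFun_eq_waveAvg, Complex.real_smul, Complex.ofReal_mul]
    ring
  simp_rw [hsplit]
  rw [intervalIntegral.integral_add (hI 0) ((hI (Real.pi / 2)).mul_const _),
    intervalIntegral.integral_mul_const, intervalIntegral.integral_ofReal,
    intervalIntegral.integral_ofReal, charFun_eq_waveAvg, charFun_eq_waveAvg,
    hf.duhamel_waveAvg k 0 hτ, hf.duhamel_waveAvg k (Real.pi / 2) hτ]
  simp only [Complex.real_smul, Complex.ofReal_add, Complex.ofReal_mul]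
  ring

end IsSolution

/-! ### The discretized Duhamel formula -/

lemma integrable_char (μ : Measure Vel) [IsFiniteMeasure μ] (k : Vel) :
    Integrable (fun v : Vel => Complex.exp (⟪v, k⟫ * Complex.I)) μ := by
  refine (integrable_const (1 : ℝ)).mono' (by fun_prop) (ae_of_all _ fun v => ?_)
  rw [Complex.norm_exp_ofReal_mul_I]

/-- The time-discretized Duhamel formula: the mixture of the freely diffused initial datum and of
the gain terms produced at the nodes of a uniform partition of `[0, τ]`, diffused afterwards. -/
def duhamelSum (e A B p : ℝ) (f₀ : ProbabilityMeasure Vel)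
    (f : ℝ → ProbabilityMeasure Vel) (τ : ℝ) (N : ℕ) : Measure Vel :=
  ENNReal.ofReal (Real.exp (-(collisionRate e * τ))) •
      ((f₀ : Measure Vel) ∗ heat (diffusionTime e A B p f τ)) +
    ∑ j ∈ Finset.range (N + 1),
      ENNReal.ofReal (∫ s in node τ N j..node τ N (j + 1), lossWeight e τ s) •
        ((gain e (f (node τ N j)) : Measure Vel) ∗
          heat (diffusionTime e A B p f τ - diffusionTime e A B p f (node τ N j)))

lemma integral_lossWeight_node_nonneg {e : ℝ} (he : e ^ 2 < 1) {τ : ℝ}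
    (hτ : 0 ≤ τ) (N j : ℕ) :
    0 ≤ ∫ s in node τ N j..node τ N (j + 1), lossWeight e τ s :=
  intervalIntegral.integral_nonneg (node_mono hτ N (Nat.le_succ j)) fun s _ =>
    lossWeight_nonneg he τ s

lemma isProbabilityMeasure_duhamelSum {e : ℝ} (he : e ^ 2 < 1) (A B p : ℝ)
    (f₀ : ProbabilityMeasure Vel) (f : ℝ → ProbabilityMeasure Vel) {τ : ℝ} (hτ : 0 ≤ τ) (N : ℕ) :
    IsProbabilityMeasure (duhamelSum e A B p f₀ f τ N) := by
  constructor
  simp only [duhamelSum, Measure.add_apply, Measure.smul_apply, Measure.finsetSum_apply,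
    measure_univ, smul_eq_mul, mul_one]
  have hw := integral_lossWeight_node_nonneg he hτ N
  rw [← ENNReal.ofReal_sum_of_nonneg fun j _ => hw j, ← ENNReal.ofReal_add (Real.exp_nonneg _)
    (Finset.sum_nonneg fun j _ => hw j), intervalIntegral.sum_integral_adjacent_intervals
    fun j _ => (continuous_lossWeight e τ).intervalIntegrable _ _, node_zero, node_last,
    integral_lossWeight]
  simp

/-- The time-discretized Duhamel formula, bundled as a probability measure. -/
def duhamelApprox {e : ℝ} (he : e ^ 2 < 1) (A B p : ℝ) (f₀ : ProbabilityMeasure Vel)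
    (f : ℝ → ProbabilityMeasure Vel) {τ : ℝ} (hτ : 0 ≤ τ) (N : ℕ) : ProbabilityMeasure Vel :=
  ⟨duhamelSum e A B p f₀ f τ N, isProbabilityMeasure_duhamelSum he A B p f₀ f hτ N⟩

namespace IsSolution

variable {e A B p : ℝ} {f₀ g₀ : ProbabilityMeasure Vel} {f g : ℝ → ProbabilityMeasure Vel}

lemma charFun_duhamelSum (hf : IsSolution e A B p f₀ f) (he : e ^ 2 < 1) (hA : 0 < A)
    (hB : 0 < B) {τ : ℝ} (hτ : 0 ≤ τ) (N : ℕ) (k : Vel) :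
    charFun (duhamelSum e A B p f₀ f τ N) k = Real.exp (-(collisionRate e * τ)) •
        ((Real.exp (-(‖k‖ ^ 2 * diffusionTime e A B p f τ)) : ℂ) * charFun (f₀ : Measure Vel) k) +
      ∑ j ∈ Finset.range (N + 1), (∫ s in node τ N j..node τ N (j + 1), lossWeight e τ s) •
        ((Real.exp (-(‖k‖ ^ 2 * (diffusionTime e A B p f τ -
            diffusionTime e A B p f (node τ N j)))) : ℂ) *
          charFun (gain e (f (node τ N j)) : Measure Vel) k) := by
  have hi : ∀ (c : ℝ) (μ : Measure Vel) [IsFiniteMeasure μ],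
      Integrable (fun v : Vel => Complex.exp (⟪v, k⟫ * Complex.I)) (ENNReal.ofReal c • μ) :=
    fun c μ _ => (integrable_char μ k).smul_measure ENNReal.ofReal_ne_top
  have hH : 0 ≤ diffusionTime e A B p f τ :=
    intervalIntegral.integral_nonneg hτ fun r _ => diffusivity_nonneg he hA hB p (f r)
  rw [charFun_apply, duhamelSum, integral_add_measure (hi _ _)
    (integrable_finsetSum_measure.2 fun j _ => hi _ _),
    integral_finsetSum_measure fun j _ => hi _ _]
  simp only [integral_smul_measure, ← charFun_apply]
  rw [charFun_conv, charFun_heat hH, ENNReal.toReal_ofReal (Real.exp_nonneg _),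
    mul_comm (charFun _ _)]
  congr 1
  refine Finset.sum_congr rfl fun j hj => ?_
  have hj' := node_mem hτ (Finset.mem_range.1 hj).le
  rw [charFun_conv, charFun_heat (sub_nonneg.2 (hf.diffusionTime_mono he hA hB hj'.1 hj'.2)),
    ENNReal.toReal_ofReal (integral_lossWeight_node_nonneg he hτ N j), mul_comm (charFun _ _)]

/-- Lévy's theorem reduces weak convergence to that of the characteristic functions, which are
Riemann sums for Duhamel's formula. -/
lemma tendsto_duhamelApprox (hf : IsSolution e A B p f₀ f) (he : e ^ 2 < 1) (hA : 0 < A)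
    (hB : 0 < B) {τ : ℝ} (hτ : 0 ≤ τ) :
    Tendsto (duhamelApprox he A B p f₀ f hτ) atTop (𝓝 (f τ)) := by
  refine ProbabilityMeasure.tendsto_iff_tendsto_charFun.2 fun k => ?_
  rw [hf.duhamel_charFun k hτ]
  simp only [duhamelApprox, ProbabilityMeasure.coe_mk, hf.charFun_duhamelSum he hA hB hτ]
  have h := tendsto_weighted_riemann_sum (continuous_lossWeight e τ)
    (lossWeight_nonneg he τ) hτ (hf.continuousOn_duhamel_charFun k hτ)
  exact h.const_add _

/-! ### The contraction estimate -/

/-- One step of the fixed-point iteration: a bound `b` for the squared distance of two solutions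
with the same accumulated diffusion improves to its image under the Duhamel formula. -/
lemma wassersteinSq_le_of_le (hf : IsSolution e A B p f₀ f) (hg : IsSolution e A B p g₀ g)
    (he : e ^ 2 < 1) (hA : 0 < A) (hB : 0 < B) {τ : ℝ} (hτ : 0 ≤ τ)
    (hH : ∀ s ∈ Icc 0 τ, diffusionTime e A B p g s = diffusionTime e A B p f s)
    {b : ℝ → ℝ} (hb : ContinuousOn b (Icc 0 τ)) (hb0 : ∀ s ∈ Icc 0 τ, 0 ≤ b s)
    {X₀ : ℝ} (hX₀ : 0 ≤ X₀)
    (h0 : wassersteinSq (f₀ : Measure Vel) (g₀ : Measure Vel) ≤ ENNReal.ofReal X₀)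
    (h : ∀ s ∈ Icc 0 τ, wassersteinSq (f s : Measure Vel) (g s : Measure Vel) ≤
      ENNReal.ofReal (b s)) :
    wassersteinSq (f τ : Measure Vel) (g τ : Measure Vel) ≤
      ENNReal.ofReal (Real.exp (-(collisionRate e * τ)) * X₀ +
        ∫ s in (0 : ℝ)..τ, lossWeight e τ s *
          ((3 + e ^ 2) / 4 * b s + (1 - e ^ 2) / 4 * ‖mean f₀ - mean g₀‖ ^ 2)) := by
  set F : ℝ → ℝ := fun s => (3 + e ^ 2) / 4 * b s + (1 - e ^ 2) / 4 * ‖mean f₀ - mean g₀‖ ^ 2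
    with hF
  have he' : 0 ≤ (1 - e ^ 2) / 4 := by linarith
  have hF0 : ∀ s ∈ Icc 0 τ, 0 ≤ F s := fun s hs => by
    have := hb0 s hs
    positivity
  refine wassersteinSq_le_of_tendsto (hf.tendsto_duhamelApprox he hA hB hτ)
    (hg.tendsto_duhamelApprox he hA hB hτ) (tendsto_const_nhds.add (tendsto_weighted_riemann_sum
      (continuous_lossWeight e τ) (lossWeight_nonneg he τ) hτ
      (F := F) (by fun_prop))) fun N => ?_
  have hw := integral_lossWeight_node_nonneg he hτ N
  have hterm : ∀ j ∈ Finset.range (N + 1), 0 ≤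
      (∫ s in node τ N j..node τ N (j + 1), lossWeight e τ s) • F (node τ N j) := fun j hj =>
    mul_nonneg (hw j) (hF0 _ (node_mem hτ (Finset.mem_range.1 hj).le))
  rw [ENNReal.ofReal_add (by positivity) (Finset.sum_nonneg hterm),
    ENNReal.ofReal_mul (Real.exp_nonneg _), ENNReal.ofReal_sum_of_nonneg hterm]
  simp only [duhamelApprox, ProbabilityMeasure.coe_mk, duhamelSum]
  refine (wassersteinSq_add_le _ _ _ _).trans (add_le_add ?_ ?_)
  · refine (wassersteinSq_smul_le ENNReal.ofReal_ne_top _ _).trans ?_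
    rw [hH τ ⟨hτ, le_rfl⟩]
    gcongr
    exact (wassersteinSq_conv_le _ _ _).trans h0
  · refine (wassersteinSq_sum_le _ (fun _ => ENNReal.ofReal_ne_top) _ _).trans
      (Finset.sum_le_sum fun j hj => ?_)
    have hj' := node_mem hτ (Finset.mem_range.1 hj).le
    rw [smul_eq_mul, ENNReal.ofReal_mul (hw j), hH τ ⟨hτ, le_rfl⟩, hH _ hj']
    gcongr
    refine (wassersteinSq_conv_le _ _ _).trans ((wassersteinSq_gain_le he.le (hf.inP2 _ hj'.1)
      (hg.inP2 _ hj'.1)).trans ?_)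
    rw [hf.mean_eq he hA hB hj'.1, hg.mean_eq he hA hB hj'.1, hF,
      ENNReal.ofReal_add (by have := hb0 _ hj'; positivity) (by positivity),
      ENNReal.ofReal_mul (p := (3 + e ^ 2) / 4) (by positivity)]
    gcongr
    exact h _ hj'

/-- The second moment is bounded on bounded time intervals. -/
lemma exists_secondMoment_le (hf : IsSolution e A B p f₀ f) (he : e ^ 2 < 1) (hA : 0 < A)
    (hB : 0 < B) {T : ℝ} (hT : 0 ≤ T) : ∃ C, ∀ s ∈ Icc 0 T, secondMoment (f s) ≤ C := by
  have hE := eight_le_collisionRate he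
  refine ⟨3 * (temperature f₀ + ∫ s in (0 : ℝ)..T, Real.exp (collisionRate e * s) *
    ((collisionRate e - 2) * temperature (f s) + 2 * diffusivity e A B p (f s))) +
    ‖mean f₀‖ ^ 2, fun s hs => ?_⟩
  have h1 := hf.temperature_balance he hA hB hs.1
  have h2 : ∫ r in (0 : ℝ)..s, Real.exp (collisionRate e * r) *
      ((collisionRate e - 2) * temperature (f r) + 2 * diffusivity e A B p (f r)) ≤
      ∫ r in (0 : ℝ)..T, Real.exp (collisionRate e * r) *
      ((collisionRate e - 2) * temperature (f r) + 2 * diffusivity e A B p (f r)) := by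
    refine intervalIntegral.integral_mono_interval le_rfl hs.1 hs.2
      (ae_of_all _ fun r => ?_) ?_
    · have h3 := diffusivity_nonneg he hA hB p (f r)
      have h4 := temperature_nonneg (f r)
      have h5 : 0 ≤ collisionRate e - 2 := by linarith
      show (0 : ℝ) ≤ _
      positivity
    · exact (((hf.intervalIntegrable_temperature he hA hB hT).const_mul _).add
        ((hf.diffusivity_integrable T hT).const_mul 2)).continuousOn_mul (by fun_prop)
  have h3 : temperature (f s) ≤ Real.exp (collisionRate e * s) * temperature (f s) :=
    le_mul_of_one_le_left (temperature_nonneg _)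
      (Real.one_le_exp (mul_nonneg (by linarith) hs.1))
  have h4 := temperature_eq (hf.inP2 s hs.1)
  rw [hf.mean_eq he hA hB hs.1] at h4
  linarith

end IsSolution

/-- The cost of the product coupling is controlled by the second moments. -/
lemma wassersteinSq_le_secondMoment {f g : ProbabilityMeasure Vel} (hf : InP2 f) (hg : InP2 g) :
    wassersteinSq (f : Measure Vel) (g : Measure Vel) ≤
      ENNReal.ofReal (2 * (secondMoment f + secondMoment g)) := by
  have hπ : HasMarginals ((f : Measure Vel).prod (g : Measure Vel)) f g :=
    ⟨by simp, by simp⟩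
  have hsub := memLp_sub_of_hasMarginals hf hg hπ
  refine (wassersteinSq_le hπ).trans ?_
  rw [cost_eq_integral hsub]
  refine ENNReal.ofReal_le_ofReal ?_
  have h1 : Integrable (fun z : Vel × Vel => ‖z.1‖ ^ 2)
      ((f : Measure Vel).prod (g : Measure Vel)) :=
    hf.integrable_normSq.comp_fst _
  have h2 : Integrable (fun z : Vel × Vel => ‖z.2‖ ^ 2)
      ((f : Measure Vel).prod (g : Measure Vel)) :=
    hg.integrable_normSq.comp_snd _
  calc ∫ z, ‖z.1 - z.2‖ ^ 2 ∂((f : Measure Vel).prod (g : Measure Vel))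
      ≤ ∫ z, 2 * (‖z.1‖ ^ 2 + ‖z.2‖ ^ 2) ∂((f : Measure Vel).prod (g : Measure Vel)) := by
        refine integral_mono (hsub.integrable_norm_pow two_ne_zero) ((h1.add h2).const_mul 2)
          fun z => ?_
        have h3 := parallelogram_law_with_norm ℝ z.1 z.2
        show ‖z.1 - z.2‖ ^ 2 ≤ 2 * (‖z.1‖ ^ 2 + ‖z.2‖ ^ 2)
        nlinarith [sq_nonneg ‖z.1 + z.2‖]
    _ = 2 * (secondMoment f + secondMoment g) := by
        rw [integral_const_mul, integral_add h1 h2,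
          integral_fun_fst (fun v : Vel => ‖v‖ ^ 2), integral_fun_snd (fun v : Vel => ‖v‖ ^ 2)]
        simp [secondMoment]

/-- The function `a(s) = M + exp (-2 s) (X₀ - M)` is a fixed point of the Duhamel iteration. -/
lemma integral_lossWeight_mul_exp {e : ℝ} (he : e ^ 2 < 1) (X₀ M τ : ℝ) :
    ∫ s in (0 : ℝ)..τ, lossWeight e τ s *
      ((3 + e ^ 2) / 4 * (M + Real.exp (-2 * s) * (X₀ - M)) + (1 - e ^ 2) / 4 * M) =
      M + Real.exp (-2 * τ) * (X₀ - M) - Real.exp (-(collisionRate e * τ)) * X₀ := by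
  have hd : ∀ s ∈ uIcc 0 τ, HasDerivAt
      (fun s => Real.exp (-(collisionRate e * (τ - s))) * (M + Real.exp (-2 * s) * (X₀ - M)))
      (lossWeight e τ s *
        ((3 + e ^ 2) / 4 * (M + Real.exp (-2 * s) * (X₀ - M)) + (1 - e ^ 2) / 4 * M)) s := by
    intro s _
    have h1 : HasDerivAt (fun s => Real.exp (-(collisionRate e * (τ - s)))) _ s :=
      ((((hasDerivAt_id s).const_sub τ).const_mul (collisionRate e)).neg).exp
    have h2 : HasDerivAt (fun s => M + Real.exp (-2 * s) * (X₀ - M)) _ s :=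
      ((((hasDerivAt_id s).const_mul (-2 : ℝ)).exp).mul_const (X₀ - M)).const_add M
    refine (h1.mul h2).congr_deriv ?_
    have h3 := collisionRate_mul he
    simp only [lossWeight, id, Pi.neg_apply]
    linear_combination Real.exp (-(collisionRate e * (τ - s))) * Real.exp (-2 * s) * (X₀ - M) * h3
  rw [intervalIntegral.integral_eq_sub_of_hasDerivAt hd (Continuous.intervalIntegrable
    ((continuous_lossWeight e τ).mul (by fun_prop)) _ _)]
  simp

namespace IsSolution

variable {e A B p : ℝ} {f₀ g₀ : ProbabilityMeasure Vel} {f g : ℝ → ProbabilityMeasure Vel}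

/-- Two solutions of the same initial temperature accumulate the same diffusion. -/
lemma diffusionTime_congr (hf : IsSolution e A B p f₀ f) (hg : IsSolution e A B p g₀ g)
    (he : e ^ 2 < 1) (hA : 0 < A) (hB : 0 < B) (hp : p < 3 / 2)
    (h0 : temperature f₀ = temperature g₀) (hpos : 1 / 2 < p → 0 < temperature f₀)
    {τ : ℝ} (hτ : 0 ≤ τ) : diffusionTime e A B p g τ = diffusionTime e A B p f τ := by
  refine intervalIntegral.integral_congr fun s hs => ?_
  rw [uIcc_of_le hτ] at hs
  have h : temperature (g s) = temperature (f s) :=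
    le_antisymm (hg.temperature_le hf he hA hB hp h0.symm hpos hs.1)
      (hf.temperature_le hg he hA hB hp h0 (fun h => h0 ▸ hpos h) hs.1)
  simp only [diffusivity, h]

/-- Contraction for two solutions with the same accumulated diffusion. A real number `X₀` is used in
place of the initial distance, so that the iteration takes place in `ℝ`. -/
lemma wassersteinSq_le (hf : IsSolution e A B p f₀ f) (hg : IsSolution e A B p g₀ g)
    (he : e ^ 2 < 1) (hA : 0 < A) (hB : 0 < B)
    (hH : ∀ s, 0 ≤ s → diffusionTime e A B p g s = diffusionTime e A B p f s)
    {X₀ : ℝ} (hX₀ : 0 ≤ X₀)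
    (h0 : wassersteinSq (f₀ : Measure Vel) (g₀ : Measure Vel) ≤ ENNReal.ofReal X₀)
    {τ : ℝ} (hτ : 0 ≤ τ) :
    wassersteinSq (f τ : Measure Vel) (g τ : Measure Vel) ≤
      ENNReal.ofReal (Real.exp (-2 * τ) * X₀ +
        (1 - Real.exp (-2 * τ)) * ‖mean f₀ - mean g₀‖ ^ 2) := by
  set M := ‖mean f₀ - mean g₀‖ ^ 2 with hM
  have hM0 : 0 ≤ M := by positivity
  have hγ0 : 0 ≤ (3 + e ^ 2) / 4 := by positivity
  have hγ1 : (3 + e ^ 2) / 4 < 1 := by linarith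
  obtain ⟨C₁, hC₁⟩ := hf.exists_secondMoment_le he hA hB hτ
  obtain ⟨C₂, hC₂⟩ := hg.exists_secondMoment_le he hA hB hτ
  have hC0 : 0 ≤ C₁ + C₂ := by
    have h1 := hC₁ 0 ⟨le_rfl, hτ⟩
    have h2 := hC₂ 0 ⟨le_rfl, hτ⟩
    linarith [secondMoment_nonneg (f 0), secondMoment_nonneg (g 0)]
  set d := 2 * (C₁ + C₂) with hd
  set a : ℝ → ℝ := fun s => M + Real.exp (-2 * s) * (X₀ - M) with ha
  have ha0 : ∀ s, 0 ≤ s → 0 ≤ a s := fun s hs => by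
    have h1 : Real.exp (-2 * s) ≤ 1 := Real.exp_le_one_iff.2 (by linarith)
    have h2 := Real.exp_pos (-2 * s)
    simp only [ha]
    nlinarith
  have hcont : Continuous a := by fun_prop
  -- The excess over the fixed point `a` is multiplied by `(3 + e²) / 4` in each step, and `d` is an
  -- initial bound from the second moments.
  have key : ∀ n : ℕ, ∀ t ∈ Icc 0 τ, wassersteinSq (f t : Measure Vel) (g t : Measure Vel) ≤
      ENNReal.ofReal (a t + ((3 + e ^ 2) / 4) ^ n * d) := by
    intro n
    induction n with
    | zero =>
      intro t ht
      refine (wassersteinSq_le_secondMoment (hf.inP2 t ht.1) (hg.inP2 t ht.1)).trans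
        (ENNReal.ofReal_le_ofReal ?_)
      have := ha0 t ht.1
      have := hC₁ t ht
      have := hC₂ t ht
      rw [pow_zero]
      linarith
    | succ n ih =>
      intro t ht
      set c := ((3 + e ^ 2) / 4) ^ n * d with hc
      have hc0 : 0 ≤ c := by positivity
      refine (hf.wassersteinSq_le_of_le hg he hA hB ht.1 (fun s hs => hH s hs.1)
        (b := fun s => a s + c) (by fun_prop) (fun s hs => add_nonneg (ha0 s hs.1) hc0) hX₀ h0
        fun s hs => ih s ⟨hs.1, hs.2.trans ht.2⟩).trans (ENNReal.ofReal_le_ofReal ?_)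
      have hsplit : ∀ s, lossWeight e t s * ((3 + e ^ 2) / 4 * (a s + c) + (1 - e ^ 2) / 4 * M) =
          lossWeight e t s * ((3 + e ^ 2) / 4 * a s + (1 - e ^ 2) / 4 * M) +
            lossWeight e t s * ((3 + e ^ 2) / 4 * c) := fun s => by ring
      have hw := continuous_lossWeight e t
      simp_rw [← hM, hsplit]
      rw [intervalIntegral.integral_add (Continuous.intervalIntegrable (by fun_prop) _ _)
        (Continuous.intervalIntegrable (by fun_prop) _ _), integral_lossWeight_mul_exp he,
        intervalIntegral.integral_mul_const, integral_lossWeight,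
        pow_succ' ((3 + e ^ 2) / 4) n, mul_assoc _ _ d, ← hc]
      have h1 : 0 ≤ Real.exp (-(collisionRate e * t)) * ((3 + e ^ 2) / 4 * c) := by positivity
      simp only [ha]
      linarith
  have hlim : Tendsto (fun n : ℕ => ENNReal.ofReal (a τ + ((3 + e ^ 2) / 4) ^ n * d)) atTop
      (𝓝 (ENNReal.ofReal (a τ))) := by
    refine (ENNReal.continuous_ofReal.tendsto _).comp ?_
    simpa using ((tendsto_pow_atTop_nhds_zero_of_lt_one hγ0 hγ1).mul_const d).const_add (a τ)
  refine (ge_of_tendsto' hlim fun n => key n τ ⟨hτ, le_rfl⟩).trans_eq (congrArg _ ?_)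
  simp only [ha]
  ring

end IsSolution

end
end InelasticMaxwell

theorem theorem3p4 (e A B p : ℝ) (he0 : 0 < e) (he1 : e < 1) (hA : 0 < A) (hB : 0 < B)
    (hp0 : 0 ≤ p) (hp1 : p < 3 / 2)
    (f₁₀ f₂₀ : ProbabilityMeasure InelasticMaxwell.Vel)
    (hf₁₀ : InelasticMaxwell.InP2 f₁₀) (hf₂₀ : InelasticMaxwell.InP2 f₂₀)
    (henergy : InelasticMaxwell.temperature f₁₀ = InelasticMaxwell.temperature f₂₀)
    (hnondeg : 1 / 2 < p → 0 < InelasticMaxwell.temperature f₁₀)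
    (f₁ f₂ : ℝ → ProbabilityMeasure InelasticMaxwell.Vel)
    (hf₁ : InelasticMaxwell.IsSolution e A B p f₁₀ f₁)
    (hf₂ : InelasticMaxwell.IsSolution e A B p f₂₀ f₂)
    (τ : ℝ) (hτ : 0 ≤ τ) :
    InelasticMaxwell.W2 (f₁ τ) (f₂ τ) ^ 2 ≤
      ENNReal.ofReal (Real.exp (-2 * τ)) * InelasticMaxwell.W2 f₁₀ f₂₀ ^ 2 +
        ENNReal.ofReal ((1 - Real.exp (-2 * τ)) *
          ‖InelasticMaxwell.mean f₁₀ - InelasticMaxwell.mean f₂₀‖ ^ 2) := by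
  have he : e ^ 2 < 1 := by nlinarith
  have hfin : InelasticMaxwell.wassersteinSq (f₁₀ : Measure InelasticMaxwell.Vel) f₂₀ ≠ ⊤ :=
    ne_top_of_le_ne_top ENNReal.ofReal_ne_top
      (InelasticMaxwell.wassersteinSq_le_secondMoment hf₁₀ hf₂₀)
  have h1 : 0 ≤ 1 - Real.exp (-2 * τ) := by
    have : Real.exp (-2 * τ) ≤ 1 := Real.exp_le_one_iff.2 (by linarith)
    linarith
  have h := hf₁.wassersteinSq_le hf₂ he hA hB
    (fun s hs => hf₁.diffusionTime_congr hf₂ he hA hB hp1 henergy hnondeg hs)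
    ENNReal.toReal_nonneg (ENNReal.ofReal_toReal hfin).ge hτ
  rw [InelasticMaxwell.W2_sq, InelasticMaxwell.W2_sq]
  rwa [ENNReal.ofReal_add (by positivity) (by positivity), ENNReal.ofReal_mul (Real.exp_nonneg _),
    ENNReal.ofReal_toReal hfin] at h
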